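/- Let $k$ be a field of characteristic different from $3$, and let $J$ be a quadratic Jordan algebra of a cubic form over $k$ with $\dim_k J=9$: that is, $J$ carries a base point $1$, a quadratic map $\sharp$, a cubic form $N$ and a symmetric bilinear trace $T(\cdot,\cdot)$, such that $N(x+y)=N(x)+T(x^\sharp,y)+T(x,y^\sharp)+N(y)$, $x^{\sharp\sharp}=N(x)x$ (together with its linearizations), $N(1)=1$, $1^\sharp=1$ and $1\sharp x=T(x)1-x$, where $x\sharp y:=(x+y)^\sharp-x^\sharp-y^\sharp$ is the $\sharp$-product and $T(x):=T(x,1)$. Put $S(x):=T(x^\sharp)$. Let $\sigma,\upsilon\in J$ with $T(\sigma)=T(\upsilon)=0$. Set $S_1=S(\sigma)$, $S_2=S(\upsilon)$, $N_1=N(\sigma)$, $N_2=N(\upsilon)$, $T_{11}=T(\sigma,\upsilon)$, $T_{12}=T(\sigma,\upsilon^\sharp)$, $T_{21}=T(\sigma^\sharp,\upsilon)$, $T_{22}=T(\sigma^\sharp,\upsilon^\sharp)$, and assume that the following element of $k$ is nonzero: $$\begin{aligned}\mathsf D={}&27 N_{1}^2 N_{2}^2 +4 N_{1}^2 S_{2}^3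 +4 N_{2}^2 S_{1}^3 +6 N_{1} N_{2} S_{1} S_{2} T_{11} -S_{1}^2 S_{2}^2 T_{11}^2\\ &+4 N_{1} N_{2} T_{11}^3 +4 N_{1} S_{1} S_{2}^2 T_{12} +4 N_{2} S_{1}^2 S_{2} T_{21} +4 N_{1} S_{2}^2 T_{11} T_{21} +4 N_{2} S_{1}^2 T_{11} T_{12}\\ &+4 N_{1} S_{2} T_{11}^2 T_{12} +4 N_{2} S_{1} T_{11}^2 T_{21} -18 N_{1} N_{2} T_{12} T_{21} -18 N_{1} N_{2} T_{11} T_{22} -T_{12}^2 T_{21}^2\\ &+4 N_{1} T_{12}^3 +4 N_{2} T_{21}^3 +4 S_{1}^2 S_{2}^2 T_{22} +2 S_{1} S_{2} T_{11} T_{12} T_{21} +2 S_{1} S_{2} T_{11}^2 T_{22}\\ &-12 N_{1} S_{2} T_{12} T_{22} -12 N_{2} S_{1} T_{21} T_{22} +2 T_{11} T_{12} T_{21} T_{22} +4 S_{1} T_{12}^2 T_{22} +4 S_{2} T_{21}^2 T_{22}\\ &-8 S_{1} S_{2} T_{22}^2 -T_{11}^2 T_{22}^2 +4 T_{22}^3.\end{aligned}$$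 Then Petersson's subalgebra $$V=\langle 1,\sigma,\sigma^\sharp,\upsilon,\upsilon^\sharp,\sigma\sharp\upsilon,\sigma\sharp\upsilon^\sharp,\sigma^\sharp\sharp\upsilon,\sigma^\sharp\sharp\upsilon^\sharp\rangle$$ is all of $J$. There is an element $\upsilon_2\in J$ with $\langle\upsilon,\upsilon^\sharp,1\rangle=\langle\upsilon,\upsilon_2,1\rangle$ and $T(\upsilon_2)=0$. For every such $\upsilon_2$, putting $\upsilon_1=\upsilon$, $\sigma_1=\sigma^\sharp$, $\sigma_2=\sigma$, $\sigma_3=1$, the following holds. There are unique $t_1,t_2,t_{123},t_{124},t_{125},t_{126},t_{135},t_{136},t_{245},t_{246}\in k$ such that $t_1=S(\sigma)$, $t_2=N(\sigma)$, $t_{123}=-T(\sigma_1,\upsilon_1)$, $t_{124}=-T(\sigma_1,\upsilon_2)$, $t_{125}=T(\sigma_2,\upsilon_1)$, $t_{126}=T(\sigma_2,\upsilon_2)$ and $$\upsilon_1^\sharp=t_{136}\upsilon_1-t_{135}\upsilon_2+\tfrac13S(\upsilon_1)1,\qquad \upsilon_2^\sharp=t_{246}\upsilon_1-t_{245}\upsilon_2+\tfrac13S(\upsilon_2)1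 .$$ With $\pi_1=\sigma_2\sharp\upsilon_1$, $\pi_2=\sigma_2^\sharp\sharp\upsilon_1+t_1\upsilon_1$, $\pi_3=\sigma_2\sharp\upsilon_2$, $\pi_4=\sigma_2^\sharp\sharp\upsilon_2+t_1\upsilon_2$, the elements $\pi_1,\pi_2,\pi_3,\pi_4,\upsilon_1,\upsilon_2,\sigma_1,\sigma_2,\sigma_3$ form a basis of $J$. Let $(p_1,p_2,p_3,p_4,u_1,u_2,s_1,s_2,s_3)$ be the coordinates of $x\in J$ in this basis. Then $x^\sharp$ is the element with coordinates $(\mathrm{ad}p_1,\mathrm{ad}p_2,\mathrm{ad}p_3,\mathrm{ad}p_4,\mathrm{ad}u_1,\mathrm{ad}u_2,\mathrm{ad}s_1,\mathrm{ad}s_2,\mathrm{ad}s_3)$ determined by $$\begin{aligned} &\mathrm{ad}p_2=F_1,\quad \mathrm{ad}p_4=F_2,\quad \mathrm{ad}p_1=F_3,\quad \mathrm{ad}p_3=F_4,\\ &-(\mathrm{ad}u_1+t_1\mathrm{ad}p_2)=F_5,\quad -(\mathrm{ad}u_2+t_1\mathrm{ad}p_4)=F_6,\quad -\mathrm{ad}s_1=F_7,\quad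 -\mathrm{ad}s_2=F_8,\\ &\mathrm{ad}s_3+t_1\mathrm{ad}s_1-t_{125}\mathrm{ad}p_1+t_{123}\mathrm{ad}p_2-t_{126}\mathrm{ad}p_3+t_{124}\mathrm{ad}p_4=F_9, \end{aligned}$$ where $$\begin{aligned} F_{1}:={}& u_{1}s_{1}-p_{1}s_{2}-p_{2}s_{3}+t_{126}(p_{2}p_{3}-p_{1}p_{4})+t_{136}(-p_{1}^{2}-t_{1}p_{2}^{2}-p_{2}u_{1})\\ & +t_{245}(-2p_{1}p_{3}-2t_{1}p_{2}p_{4}-p_{4}u_{1}-p_{2}u_{2})+t_{246}(-p_{3}^{2}-t_{1}p_{4}^{2}-p_{4}u_{2}),\\ F_{2}:={}& u_{2}s_{1}-p_{3}s_{2}-p_{4}s_{3}+t_{125}(-p_{2}p_{3}+p_{1}p_{4})+t_{135}(p_{1}^{2}+t_{1}p_{2}^{2}+p_{2}u_{1})\\ & +t_{136}(2p_{1}p_{3}+2t_{1}p_{2}p_{4}+p_{4}u_{1}+p_{2}u_{2})+t_{245}(p_{3}^{2}+t_{1}p_{4}^{2}+p_{4}u_{2}),\\ F_{3}:={}& -t_{2}p_{2}s_{1}+(t_{1}p_{2}+u_{1})s_{2}-p_{1}s_{3}+t_{124}(p_{2}p_{3}-p_{1}p_{4})\\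 & +t_{136}(-p_{2}^{2}t_{2}-p_{1}u_{1})+t_{245}(-2t_{2}p_{2}p_{4}-p_{3}u_{1}-p_{1}u_{2})+t_{246}(-t_{2}p_{4}^{2}-p_{3}u_{2}),\\ F_{4}:={}& -t_{2}p_{4}s_{1}+(t_{1}p_{4}+u_{2})s_{2}-p_{3}s_{3}+t_{123}(-p_{2}p_{3}+p_{1}p_{4})+t_{135}(t_{2}p_{2}^{2}+p_{1}u_{1})\\ & +t_{136}(2t_{2}p_{2}p_{4}+p_{3}u_{1}+p_{1}u_{2})+t_{245}(t_{2}p_{4}^{2}+p_{3}u_{2}),\\ F_{5}:={}& -t_{2}p_{1}s_{1}+(t_{1}p_{1}-t_{2}p_{2})s_{2}+(t_{1}p_{2}+u_{1})s_{3}\\ & +t_{123}(t_{1}p_{2}^{2}+p_{1}^{2}+p_{2}u_{1})+t_{124}(t_{1}p_{2}p_{4}+p_{1}p_{3}+p_{2}u_{2})\\ & -t_{125}(t_{2}p_{2}^{2}+p_{1}u_{1})-t_{126}(t_{2}p_{2}p_{4}+p_{1}u_{2})-t_{136}(t_{1}p_{2}u_{1}-t_{2}p_{1}p_{2}+u_{1}^{2})\\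 & -t_{245}(t_{1}p_{4}u_{1}+t_{1}p_{2}u_{2}-t_{2}p_{2}p_{3}-t_{2}p_{1}p_{4}+2u_{1}u_{2})\\ & -t_{246}(t_{1}p_{4}u_{2}-t_{2}p_{3}p_{4}+u_{2}^{2}),\\ F_{6}:={}& -t_{2}p_{3}s_{1}+(t_{1}p_{3}-t_{2}p_{4})s_{2}+(t_{1}p_{4}+u_{2})s_{3}\\ & +t_{123}(p_{1}p_{3}+t_{1}p_{2}p_{4}+p_{4}u_{1})+t_{124}(p_{3}^{2}+t_{1}p_{4}^{2}+p_{4}u_{2})\\ & -t_{125}(t_{2}p_{2}p_{4}+p_{3}u_{1})-t_{126}(t_{2}p_{4}^{2}+p_{3}u_{2})+t_{135}(t_{1}p_{2}u_{1}-t_{2}p_{1}p_{2}+u_{1}^{2})\\ & +t_{136}(t_{1}p_{4}u_{1}+t_{1}p_{2}u_{2}-t_{2}p_{2}p_{3}-t_{2}p_{1}p_{4}+2u_{1}u_{2})\\ & +t_{245}(t_{1}p_{4}u_{2}-t_{2}p_{3}p_{4}+u_{2}^{2}),\\ F_{7}:={}& -s_{2}^{2}+s_{1}s_{3}+(t_{123}p_{2}+t_{124}p_{4})s_{1}-(t_{125}p_{2}+t_{126}p_{4})s_{2}\\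 & +(t_{136}^{2}-t_{135}t_{245})(p_{1}^{2}-2p_{2}u_{1}-t_{1}p_{2}^{2})+(t_{245}^{2}-t_{136}t_{246})(p_{3}^{2}-2p_{4}u_{2}-t_{1}p_{4}^{2})\\ & +(t_{135}t_{246}-t_{136}t_{245})(p_{2}u_{2}+p_{4}u_{1}-p_{1}p_{3}+t_{1}p_{2}p_{4})\\ & +(t_{123}t_{136}-t_{124}t_{135})p_{2}^{2}+2(t_{123}t_{245}-t_{124}t_{136})p_{2}p_{4}+(t_{123}t_{246}-t_{124}t_{245})p_{4}^{2}\\ & +(t_{126}t_{135}-t_{125}t_{136})p_{1}p_{2}+(t_{126}t_{136}-t_{125}t_{245})(p_{1}p_{4}+p_{2}p_{3})\\ & +(t_{126}t_{245}-t_{125}t_{246})p_{3}p_{4},\\ F_{8}:={}& (s_{2}s_{3}+t_{1}s_{1}s_{2}-t_{2}s_{1}^{2})+(t_{123}p_{1}+t_{124}p_{3})s_{1}-(t_{125}p_{1}+t_{126}p_{3})s_{2}\\ & +(t_{136}^{2}-t_{135}t_{245})(-2p_{1}u_{1}-2t_{1}p_{1}p_{2}+t_{2}p_{2}^{2})+(t_{245}^{2}-t_{136}t_{246})(-2p_{3}u_{2}-2t_{1}p_{3}p_{4}+t_{2}p_{4}^{2})\\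 & +(t_{135}t_{246}-t_{136}t_{245})\left(p_{1}u_{2}+p_{3}u_{1}+t_{1}(p_{1}p_{4}+p_{2}p_{3})-t_{2}p_{2}p_{4}\right)\\ & +(t_{126}t_{135}-t_{125}t_{136})p_{1}^{2}+2(t_{126}t_{136}-t_{125}t_{245})p_{1}p_{3}+(t_{126}t_{245}-t_{125}t_{246})p_{3}^{2}\\ & +(t_{123}t_{136}-t_{124}t_{135})p_{1}p_{2}+(t_{123}t_{245}-t_{124}t_{136})(p_{1}p_{4}+p_{2}p_{3})\\ & +(t_{123}t_{246}-t_{124}t_{245})p_{3}p_{4},\\ F_{9}:={}& (s_{3}^{2}+t_{1}s_{2}^{2}-t_{2}s_{1}s_{2})+(t_{123}u_{1}+t_{124}u_{2})s_{1}-(t_{125}u_{1}+t_{126}u_{2})s_{2}\\ & +(-t_{136}^{2}+t_{135}t_{245})(2t_{2}p_{1}p_{2}+u_{1}^{2})+(-t_{136}t_{245}+t_{135}t_{246})\left(t_{2}(p_{2}p_{3}+p_{1}p_{4})+u_{1}u_{2}\right)\\ & +(-t_{245}^{2}+t_{136}t_{246})(2t_{2}p_{3}p_{4}+u_{2}^{2})\\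 & -t_{1}\left((t_{123}t_{136}-t_{124}t_{135})p_{2}^{2}+2(t_{123}t_{245}-t_{124}t_{136})p_{2}p_{4}+(t_{123}t_{246}-t_{124}t_{245})p_{4}^{2}\right)\\ & +t_{2}\left((t_{125}t_{136}-t_{126}t_{135})p_{2}^{2}+2(t_{125}t_{245}-t_{126}t_{136})p_{2}p_{4}+(t_{125}t_{246}-t_{126}t_{245})p_{4}^{2}\right)\\ & +(t_{124}t_{135}-t_{123}t_{136})p_{1}^{2}-2(-t_{124}t_{136}+t_{123}t_{245})p_{1}p_{3}+(t_{124}t_{245}-t_{123}t_{246})p_{3}^{2}\\ & +(t_{124}t_{125}-t_{123}t_{126})(-p_{2}p_{3}+p_{1}p_{4}). \end{aligned}$$ Equivalently, if coordinates are taken with respect to the basis obtained by multiplying all nine basis vectors by $\tfrac13$ (with the same parameters $t_\bullet$), then $\sharp$ is given by the same equations with each left-hand side multiplied by $3$, i.e. $3\,\mathrm{ad}p_2=F_1$, $3\,\mathrm{ad}p_4=F_2$, $3\,\mathrm{ad}p_1=F_3$, $3\,\mathrm{ad}p_3=F_4$, $-3(\mathrm{ad}u_1+t_1\mathrm{ad}p_2)=F_5$,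 and so on. -/

import Mathlib

/-- The data of a quadratic Jordan algebra of a cubic form on a vector space `J` over a field `k`
of arbitrary characteristic: a base point `one`, a quadratic map `sharp`, a cubic form `norm` and
the bilinear trace `trace`, subject to the usual axioms. The identities `sharp_cross` and
`cross_sharp` are the linearizations of `sharp_sharp`, so that the axioms hold in all scalar
extensions also when `k` is small. The `♯`-product `x ♯ y` is the polarization
`(x + y)♯ - x♯ - y♯` of `sharp`, and the `U`-operators of the Jordan structure are
`U_x y = trace x y • x - x♯ ♯ y`. -/
structure CubicJordan (k J : Type*) [Field k] [AddCommGroup J] [Module k J] where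
  one : J
  sharp : QuadraticMap k J J
  norm : J → k
  trace : LinearMap.BilinForm k J
  trace_symm : ∀ x y, trace x y = trace y x
  norm_smul : ∀ (a : k) (x : J), norm (a • x) = a ^ 3 * norm x
  norm_add : ∀ x y,
    norm (x + y) = norm x + trace (sharp x) y + trace x (sharp y) + norm y
  sharp_sharp : ∀ x, sharp (sharp x) = norm x • x
  sharp_cross : ∀ x y,
    QuadraticMap.polar sharp (sharp x) (QuadraticMap.polar sharp x y)
      = norm x • y + trace (sharp x) y • x
  cross_sharp : ∀ x y,
    QuadraticMap.polar sharp (sharp x) (sharp y) + sharp (QuadraticMap.polar sharp x y)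
      = trace (sharp x) y • y + trace x (sharp y) • x
  norm_one : norm one = 1
  sharp_one : sharp one = one
  one_cross : ∀ x, QuadraticMap.polar sharp one x = trace x one • one - x

namespace CubicJordan

variable {k J : Type*} [Field k] [AddCommGroup J] [Module k J] (A : CubicJordan k J)

/-- The `♯`-product `x ♯ y = (x + y)♯ - x♯ - y♯`. -/
def cross (x y : J) : J := QuadraticMap.polar A.sharp x y

/-- The linear trace `T(x) = T(x, 1)`. -/
def tr (x : J) : k := A.trace x A.one

/-- The quadratic form `S(x) = T(x♯)`. -/
def quad (x : J) : k := A.tr (A.sharp x)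

/-- The polynomial `D` in the eight scalars `S₁, S₂, N₁, N₂, T₁₁, T₁₂, T₂₁, T₂₂`. -/
def discPoly {k : Type*} [Field k] (S1 S2 N1 N2 T11 T12 T21 T22 : k) : k :=
  27 * N1 ^ 2 * N2 ^ 2 + 4 * N1 ^ 2 * S2 ^ 3 + 4 * N2 ^ 2 * S1 ^ 3
    + 6 * N1 * N2 * S1 * S2 * T11 - S1 ^ 2 * S2 ^ 2 * T11 ^ 2 + 4 * N1 * N2 * T11 ^ 3
    + 4 * N1 * S1 * S2 ^ 2 * T12 + 4 * N2 * S1 ^ 2 * S2 * T21 + 4 * N1 * S2 ^ 2 * T11 * T21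
    + 4 * N2 * S1 ^ 2 * T11 * T12 + 4 * N1 * S2 * T11 ^ 2 * T12
    + 4 * N2 * S1 * T11 ^ 2 * T21 - 18 * N1 * N2 * T12 * T21 - 18 * N1 * N2 * T11 * T22
    - T12 ^ 2 * T21 ^ 2 + 4 * N1 * T12 ^ 3 + 4 * N2 * T21 ^ 3 + 4 * S1 ^ 2 * S2 ^ 2 * T22
    + 2 * S1 * S2 * T11 * T12 * T21 + 2 * S1 * S2 * T11 ^ 2 * T22 - 12 * N1 * S2 * T12 * T22
    - 12 * N2 * S1 * T21 * T22 + 2 * T11 * T12 * T21 * T22 + 4 * S1 * T12 ^ 2 * T22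
    + 4 * S2 * T21 ^ 2 * T22 - 8 * S1 * S2 * T22 ^ 2 - T11 ^ 2 * T22 ^ 2 + 4 * T22 ^ 3

/-- The value of `D` at a pair `σ, υ` of elements of `J`. -/
def disc (σ υ : J) : k :=
  discPoly (A.quad σ) (A.quad υ) (A.norm σ) (A.norm υ)
    (A.trace σ υ) (A.trace σ (A.sharp υ)) (A.trace (A.sharp σ) υ)
    (A.trace (A.sharp σ) (A.sharp υ))

/-- The nine generators
`1, σ, σ♯, υ, υ♯, σ ♯ υ, σ ♯ υ♯, σ♯ ♯ υ, σ♯ ♯ υ♯` of Petersson's subalgebra. -/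
def peterssonGens (σ υ : J) : Fin 9 → J :=
  ![A.one, σ, A.sharp σ, υ, A.sharp υ, A.cross σ υ, A.cross σ (A.sharp υ),
    A.cross (A.sharp σ) υ, A.cross (A.sharp σ) (A.sharp υ)]

/-- Petersson's subalgebra `V` attached to `σ, υ`, as a subspace of `J`. -/
def peterssonSpan (σ υ : J) : Submodule k J :=
  Submodule.span k (Set.range (A.peterssonGens σ υ))

/-- `υ₂` is an admissible second vector: `⟨υ, υ♯, 1⟩ = ⟨υ, υ₂, 1⟩` and `T(υ₂) = 0`. -/
def IsAdmissible (υ υ₂ : J) : Prop :=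
  Submodule.span k {υ, A.sharp υ, A.one} = Submodule.span k {υ, υ₂, A.one} ∧ A.tr υ₂ = 0

/-- The new basis `π₁, π₂, π₃, π₄, υ₁, υ₂, σ₁, σ₂, σ₃`, where `υ₁ = υ`, `σ₁ = σ♯`, `σ₂ = σ`,
`σ₃ = 1`, `π₁ = σ ♯ υ₁`, `π₂ = σ♯ ♯ υ₁ + S(σ) υ₁`, `π₃ = σ ♯ υ₂`, `π₄ = σ♯ ♯ υ₂ + S(σ) υ₂`. -/
def newBasis (σ υ υ₂ : J) : Fin 9 → J :=
  ![A.cross σ υ, A.cross (A.sharp σ) υ + A.quad σ • υ,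
    A.cross σ υ₂, A.cross (A.sharp σ) υ₂ + A.quad σ • υ₂,
    υ, υ₂, A.sharp σ, σ, A.one]

/-- The ten parameters. -/
structure Params (k : Type*) where
  (t1 t2 t123 t124 t125 t126 t135 t136 t245 t246 : k)

/-- `t` is the system of parameters attached to `σ`, `υ₁ = υ` and `υ₂`. -/
structure IsParams (σ υ υ₂ : J) (t : Params k) : Prop where
  t1_eq : t.t1 = A.quad σ
  t2_eq : t.t2 = A.norm σ
  t123_eq : t.t123 = -A.trace (A.sharp σ) υ
  t124_eq : t.t124 = -A.trace (A.sharp σ) υ₂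
  t125_eq : t.t125 = A.trace σ υ
  t126_eq : t.t126 = A.trace σ υ₂
  sharp_fst : A.sharp υ = t.t136 • υ - t.t135 • υ₂ + ((1 / 3 : k) * A.quad υ) • A.one
  sharp_snd : A.sharp υ₂ = t.t246 • υ - t.t245 • υ₂ + ((1 / 3 : k) * A.quad υ₂) • A.one

/-- Nine coordinates. -/
structure Coord (k : Type*) where
  (p1 p2 p3 p4 u1 u2 s1 s2 s3 : k)

/-- The element of `J` with coordinates `x` with respect to the family `B`. -/
def combo (B : Fin 9 → J) (x : Coord k) : J :=
  x.p1 • B 0 + x.p2 • B 1 + x.p3 • B 2 + x.p4 • B 3 + x.u1 • B 4 + x.u2 • B 5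
    + x.s1 • B 6 + x.s2 • B 7 + x.s3 • B 8

/-- The quadric `F1`. -/
def F1 {k : Type*} [Field k] (t : Params k) (x : Coord k) : k :=
  x.u1 * x.s1 - x.p1 * x.s2 - x.p2 * x.s3 + t.t126 * (x.p2 * x.p3 - x.p1 * x.p4)
    + t.t136 * (-x.p1 ^ 2 - t.t1 * x.p2 ^ 2 - x.p2 * x.u1)
    + t.t245 * (-2 * x.p1 * x.p3 - 2 * t.t1 * x.p2 * x.p4 - x.p4 * x.u1 - x.p2 * x.u2)
    + t.t246 * (-x.p3 ^ 2 - t.t1 * x.p4 ^ 2 - x.p4 * x.u2)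

/-- The quadric `F2`. -/
def F2 {k : Type*} [Field k] (t : Params k) (x : Coord k) : k :=
  x.u2 * x.s1 - x.p3 * x.s2 - x.p4 * x.s3 + t.t125 * (-x.p2 * x.p3 + x.p1 * x.p4)
    + t.t135 * (x.p1 ^ 2 + t.t1 * x.p2 ^ 2 + x.p2 * x.u1)
    + t.t136 * (2 * x.p1 * x.p3 + 2 * t.t1 * x.p2 * x.p4 + x.p4 * x.u1 + x.p2 * x.u2)
    + t.t245 * (x.p3 ^ 2 + t.t1 * x.p4 ^ 2 + x.p4 * x.u2)

/-- The quadric `F3`. -/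
def F3 {k : Type*} [Field k] (t : Params k) (x : Coord k) : k :=
  -t.t2 * x.p2 * x.s1 + (t.t1 * x.p2 + x.u1) * x.s2 - x.p1 * x.s3
    + t.t124 * (x.p2 * x.p3 - x.p1 * x.p4) + t.t136 * (-x.p2 ^ 2 * t.t2 - x.p1 * x.u1)
    + t.t245 * (-2 * t.t2 * x.p2 * x.p4 - x.p3 * x.u1 - x.p1 * x.u2)
    + t.t246 * (-t.t2 * x.p4 ^ 2 - x.p3 * x.u2)

/-- The quadric `F4`. -/
def F4 {k : Type*} [Field k] (t : Params k) (x : Coord k) : k :=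
  -t.t2 * x.p4 * x.s1 + (t.t1 * x.p4 + x.u2) * x.s2 - x.p3 * x.s3
    + t.t123 * (-x.p2 * x.p3 + x.p1 * x.p4) + t.t135 * (t.t2 * x.p2 ^ 2 + x.p1 * x.u1)
    + t.t136 * (2 * t.t2 * x.p2 * x.p4 + x.p3 * x.u1 + x.p1 * x.u2)
    + t.t245 * (t.t2 * x.p4 ^ 2 + x.p3 * x.u2)

/-- The quadric `F5`. -/
def F5 {k : Type*} [Field k] (t : Params k) (x : Coord k) : k :=
  -t.t2 * x.p1 * x.s1 + (t.t1 * x.p1 - t.t2 * x.p2) * x.s2 + (t.t1 * x.p2 + x.u1) * x.s3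
    + t.t123 * (t.t1 * x.p2 ^ 2 + x.p1 ^ 2 + x.p2 * x.u1)
    + t.t124 * (t.t1 * x.p2 * x.p4 + x.p1 * x.p3 + x.p2 * x.u2)
    - t.t125 * (t.t2 * x.p2 ^ 2 + x.p1 * x.u1) - t.t126 * (t.t2 * x.p2 * x.p4 + x.p1 * x.u2)
    - t.t136 * (t.t1 * x.p2 * x.u1 - t.t2 * x.p1 * x.p2 + x.u1 ^ 2)
    - t.t245 * (t.t1 * x.p4 * x.u1 + t.t1 * x.p2 * x.u2 - t.t2 * x.p2 * x.p3 - t.t2 * x.p1 * x.p4 + 2 * x.u1 * x.u2)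
    - t.t246 * (t.t1 * x.p4 * x.u2 - t.t2 * x.p3 * x.p4 + x.u2 ^ 2)

/-- The quadric `F6`. -/
def F6 {k : Type*} [Field k] (t : Params k) (x : Coord k) : k :=
  -t.t2 * x.p3 * x.s1 + (t.t1 * x.p3 - t.t2 * x.p4) * x.s2 + (t.t1 * x.p4 + x.u2) * x.s3
    + t.t123 * (x.p1 * x.p3 + t.t1 * x.p2 * x.p4 + x.p4 * x.u1)
    + t.t124 * (x.p3 ^ 2 + t.t1 * x.p4 ^ 2 + x.p4 * x.u2)
    - t.t125 * (t.t2 * x.p2 * x.p4 + x.p3 * x.u1) - t.t126 * (t.t2 * x.p4 ^ 2 + x.p3 * x.u2)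
    + t.t135 * (t.t1 * x.p2 * x.u1 - t.t2 * x.p1 * x.p2 + x.u1 ^ 2)
    + t.t136 * (t.t1 * x.p4 * x.u1 + t.t1 * x.p2 * x.u2 - t.t2 * x.p2 * x.p3 - t.t2 * x.p1 * x.p4 + 2 * x.u1 * x.u2)
    + t.t245 * (t.t1 * x.p4 * x.u2 - t.t2 * x.p3 * x.p4 + x.u2 ^ 2)

/-- The quadric `F7`. -/
def F7 {k : Type*} [Field k] (t : Params k) (x : Coord k) : k :=
  -x.s2 ^ 2 + x.s1 * x.s3 + (t.t123 * x.p2 + t.t124 * x.p4) * x.s1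
    - (t.t125 * x.p2 + t.t126 * x.p4) * x.s2
    + (t.t136 ^ 2 - t.t135 * t.t245) * (x.p1 ^ 2 - 2 * x.p2 * x.u1 - t.t1 * x.p2 ^ 2)
    + (t.t245 ^ 2 - t.t136 * t.t246) * (x.p3 ^ 2 - 2 * x.p4 * x.u2 - t.t1 * x.p4 ^ 2)
    + (t.t135 * t.t246 - t.t136 * t.t245) * (x.p2 * x.u2 + x.p4 * x.u1 - x.p1 * x.p3 + t.t1 * x.p2 * x.p4)
    + (t.t123 * t.t136 - t.t124 * t.t135) * x.p2 ^ 2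
    + 2 * (t.t123 * t.t245 - t.t124 * t.t136) * x.p2 * x.p4
    + (t.t123 * t.t246 - t.t124 * t.t245) * x.p4 ^ 2
    + (t.t126 * t.t135 - t.t125 * t.t136) * x.p1 * x.p2
    + (t.t126 * t.t136 - t.t125 * t.t245) * (x.p1 * x.p4 + x.p2 * x.p3)
    + (t.t126 * t.t245 - t.t125 * t.t246) * x.p3 * x.p4

/-- The quadric `F8`. -/
def F8 {k : Type*} [Field k] (t : Params k) (x : Coord k) : k :=
  (x.s2 * x.s3 + t.t1 * x.s1 * x.s2 - t.t2 * x.s1 ^ 2)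
    + (t.t123 * x.p1 + t.t124 * x.p3) * x.s1 - (t.t125 * x.p1 + t.t126 * x.p3) * x.s2
    + (t.t136 ^ 2 - t.t135 * t.t245) * (-2 * x.p1 * x.u1 - 2 * t.t1 * x.p1 * x.p2 + t.t2 * x.p2 ^ 2)
    + (t.t245 ^ 2 - t.t136 * t.t246) * (-2 * x.p3 * x.u2 - 2 * t.t1 * x.p3 * x.p4 + t.t2 * x.p4 ^ 2)
    + (t.t135 * t.t246 - t.t136 * t.t245) * (x.p1 * x.u2 + x.p3 * x.u1 + t.t1 * (x.p1 * x.p4 + x.p2 * x.p3) - t.t2 * x.p2 * x.p4)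
    + (t.t126 * t.t135 - t.t125 * t.t136) * x.p1 ^ 2
    + 2 * (t.t126 * t.t136 - t.t125 * t.t245) * x.p1 * x.p3
    + (t.t126 * t.t245 - t.t125 * t.t246) * x.p3 ^ 2
    + (t.t123 * t.t136 - t.t124 * t.t135) * x.p1 * x.p2
    + (t.t123 * t.t245 - t.t124 * t.t136) * (x.p1 * x.p4 + x.p2 * x.p3)
    + (t.t123 * t.t246 - t.t124 * t.t245) * x.p3 * x.p4

/-- The quadric `F9`. -/
def F9 {k : Type*} [Field k] (t : Params k) (x : Coord k) : k :=
  (x.s3 ^ 2 + t.t1 * x.s2 ^ 2 - t.t2 * x.s1 * x.s2) + (t.t123 * x.u1 + t.t124 * x.u2) * x.s1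
    - (t.t125 * x.u1 + t.t126 * x.u2) * x.s2
    + (-t.t136 ^ 2 + t.t135 * t.t245) * (2 * t.t2 * x.p1 * x.p2 + x.u1 ^ 2)
    + (-t.t136 * t.t245 + t.t135 * t.t246) * (t.t2 * (x.p2 * x.p3 + x.p1 * x.p4) + x.u1 * x.u2)
    + (-t.t245 ^ 2 + t.t136 * t.t246) * (2 * t.t2 * x.p3 * x.p4 + x.u2 ^ 2)
    - t.t1 * ((t.t123 * t.t136 - t.t124 * t.t135) * x.p2 ^ 2 + 2 * (t.t123 * t.t245 - t.t124 * t.t136) * x.p2 * x.p4 + (t.t123 * t.t246 - t.t124 * t.t245) * x.p4 ^ 2)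
    + t.t2 * ((t.t125 * t.t136 - t.t126 * t.t135) * x.p2 ^ 2 + 2 * (t.t125 * t.t245 - t.t126 * t.t136) * x.p2 * x.p4 + (t.t125 * t.t246 - t.t126 * t.t245) * x.p4 ^ 2)
    + (t.t124 * t.t135 - t.t123 * t.t136) * x.p1 ^ 2
    - 2 * (-t.t124 * t.t136 + t.t123 * t.t245) * x.p1 * x.p3
    + (t.t124 * t.t245 - t.t123 * t.t246) * x.p3 ^ 2
    + (t.t124 * t.t125 - t.t123 * t.t126) * (-x.p2 * x.p3 + x.p1 * x.p4)

/-- The nine equations that express the coordinates `a = (ad p₁, …, ad s₃)` of the image through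
the quadrics `F₁, …, F₉` in the coordinates `x = (p₁, …, s₃)`, with normalizing factor `c`. -/
def SharpRel {k : Type*} [Field k] (c : k) (t : Params k) (x a : Coord k) : Prop :=
  c * a.p2 = F1 t x ∧
  c * a.p4 = F2 t x ∧
  c * a.p1 = F3 t x ∧
  c * a.p3 = F4 t x ∧
  -c * (a.u1 + t.t1 * a.p2) = F5 t x ∧
  -c * (a.u2 + t.t1 * a.p4) = F6 t x ∧
  -c * a.s1 = F7 t x ∧
  -c * a.s2 = F8 t x ∧
  c * (a.s3 + t.t1 * a.s1 - t.t125 * a.p1 + t.t123 * a.p2 - t.t126 * a.p3 + t.t124 * a.p4)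
    = F9 t x

end CubicJordan

namespace CubicJordan

variable {k J : Type*} [Field k] [AddCommGroup J] [Module k J] (A : CubicJordan k J)

/-! The trace form on the nine Petersson generators has entries polynomial in the eight scalars
entering `disc`. One explicit combination of the generators, `dualTop`, is orthogonal to the first
eight and pairs to `A.disc σ υ` with the last (`trace_dualTop`). So if `disc` is nonzero, every
linear relation has vanishing top coefficient. Multiplying a relation by σ or υ gives further
relations in which other coefficients have moved up, so all coefficients vanish
(`linearIndependent_peterssonGens`), and dimension 9 gives V = J.

Since υ, υ♯, 1 are now independent, an admissible υ₂ is a combination of υ and υ♯ - (S(υ)/3)·1 with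
nonzero coefficient at the latter. The span of υ, υ₂, 1 is then closed under ♯, and the identity υ♯♯
= N(υ)υ forces all its products into the normal form of a cubic ring with four structure constants
(`isCubicPair_of_sharp`).

The linearized adjoint identities, together with this normal form, express every product of two new
basis vectors in that basis. Expanding x♯ and collecting coefficients yields F₁, …, F₉
(`sharp_combo_newBasis`). Nothing is divided by 2; division by 3 only serves to make υ₂ traceless
and to rescale the basis. -/

/-! ### Bilinearity of the ♯-product and first trace identities. -/

lemma cross_add_left (x y z : J) : A.cross (x + y) z = A.cross x z + A.cross y z :=
  QuadraticMap.polar_add_left A.sharp x y z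

lemma cross_add_right (x y z : J) : A.cross x (y + z) = A.cross x y + A.cross x z :=
  QuadraticMap.polar_add_right A.sharp x y z

lemma cross_sub_left (x y z : J) : A.cross (x - y) z = A.cross x z - A.cross y z :=
  QuadraticMap.polar_sub_left A.sharp x y z

lemma cross_sub_right (x y z : J) : A.cross x (y - z) = A.cross x y - A.cross x z :=
  QuadraticMap.polar_sub_right A.sharp x y z

lemma cross_smul_left (a : k) (x y : J) : A.cross (a • x) y = a • A.cross x y :=
  QuadraticMap.polar_smul_left A.sharp a x y

lemma cross_smul_right (a : k) (x y : J) : A.cross x (a • y) = a • A.cross x y :=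
  QuadraticMap.polar_smul_right A.sharp a x y

lemma cross_comm (x y : J) : A.cross x y = A.cross y x :=
  QuadraticMap.polar_comm A.sharp x y

lemma cross_self (x : J) : A.cross x x = (2 : k) • A.sharp x := by
  rw [cross, QuadraticMap.polar_self, two_smul, two_smul]

lemma cross_zero_right (x : J) : A.cross x 0 = 0 := by
  simpa using A.cross_smul_right 0 x 0

lemma sharp_add (x y : J) : A.sharp (x + y) = A.sharp x + A.sharp y + A.cross x y := by
  simp only [cross, QuadraticMap.polar]; abel

lemma sharp_smul (a : k) (x : J) : A.sharp (a • x) = a ^ 2 • A.sharp x := by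
  rw [QuadraticMap.map_smul, pow_two]

lemma tr_add (x y : J) : A.tr (x + y) = A.tr x + A.tr y := by simp [tr]

lemma tr_sub (x y : J) : A.tr (x - y) = A.tr x - A.tr y := by simp [tr]

lemma tr_smul (a : k) (x : J) : A.tr (a • x) = a * A.tr x := by simp [tr]

lemma cross_one_left (x : J) : A.cross A.one x = A.tr x • A.one - x := A.one_cross x

lemma cross_one_right (x : J) : A.cross x A.one = A.tr x • A.one - x := by
  rw [cross_comm, cross_one_left]

lemma one_ne_zero : A.one ≠ 0 := by
  intro h
  have h1 := A.norm_smul 0 A.one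
  rw [zero_smul, ← h, A.norm_one] at h1
  simp at h1

lemma eq_of_smul_one_eq {a b : k} (h : a • A.one = b • A.one) : a = b :=
  smul_left_injective k A.one_ne_zero h

lemma tr_one : A.tr A.one = 3 := by
  apply A.eq_of_smul_one_eq
  have h := A.cross_one_left A.one
  rw [cross_self, A.sharp_one] at h
  linear_combination (norm := module) -h

/-- The trilinear form `T(x ♯ y, z)` is totally symmetric. -/
lemma trace_cross_left (x y z : J) : A.trace (A.cross x y) z = A.trace x (A.cross y z) := by
  -- Both bracketings of N(x + y + z) are expanded; their difference is exactly the associativity of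
  -- the trace.
  have h1 := A.norm_add (x + y) z
  have h2 := A.norm_add x (y + z)
  rw [A.norm_add x y, sharp_add] at h1
  rw [A.norm_add y z, sharp_add] at h2
  rw [add_assoc] at h1
  simp only [map_add, LinearMap.add_apply] at h1 h2
  linear_combination h2 - h1

lemma trace_one_left (x : J) : A.trace A.one x = A.tr x := A.trace_symm _ _

lemma trace_one_right (x : J) : A.trace x A.one = A.tr x := rfl

lemma tr_cross (x y : J) : A.tr (A.cross x y) = A.tr x * A.tr y - A.trace x y := by
  rw [tr, trace_cross_left, cross_one_right]
  simp [tr, mul_comm]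

lemma tr_sharp (x : J) : A.tr (A.sharp x) = A.quad x := rfl

lemma quad_one : A.quad A.one = 3 := by rw [quad, A.sharp_one, tr_one]

lemma trace_self (x : J) : A.trace x x = A.tr x ^ 2 - 2 * A.quad x := by
  have h := A.tr_cross x x
  rw [cross_self, tr_smul] at h
  rw [quad]
  linear_combination h

/-! ### Linearized adjoint identities. -/

lemma sharp_cross_cross (x y : J) :
    A.cross (A.sharp x) (A.cross x y) = A.norm x • y + A.trace (A.sharp x) y • x :=
  A.sharp_cross x y

lemma sharp_of_cross (x y : J) :
    A.sharp (A.cross x y) = A.trace (A.sharp x) y • y + A.trace x (A.sharp y) • x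
      - A.cross (A.sharp x) (A.sharp y) :=
  eq_sub_of_add_eq' (A.cross_sharp x y)

/-- Polarization of `sharp_of_cross` in its second argument. -/
lemma cross_cross_cross (x y z : J) :
    A.cross (A.cross x y) (A.cross x z) = A.trace (A.sharp x) y • z + A.trace (A.sharp x) z • y
      + A.trace x (A.cross y z) • x - A.cross (A.sharp x) (A.cross y z) := by
  have h := A.sharp_of_cross x (y + z)
  rw [cross_add_right, sharp_add, sharp_add, A.sharp_of_cross x y, A.sharp_of_cross x z] at h
  simp only [map_add, cross_add_right] at h
  linear_combination (norm := module) h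

/-- Polarizing also in the first argument gives the fully multilinear form; putting w = 1 then
produces rules for iterated products. -/
lemma cross_cross_cross_cyclic (w x y z : J) :
    A.cross (A.cross w x) (A.cross y z) + A.cross (A.cross w y) (A.cross x z)
      + A.cross (A.cross w z) (A.cross x y)
      = A.trace x (A.cross y z) • w + A.trace w (A.cross y z) • x + A.trace w (A.cross x z) • y
        + A.trace w (A.cross x y) • z := by
  have h := A.cross_cross_cross (w + x) y z
  rw [sharp_add] at h
  simp only [cross_add_left, cross_add_right, map_add, LinearMap.add_apply,
    A.cross_cross_cross w y z, A.cross_cross_cross x y z] at h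
  rw [A.cross_comm (A.cross x y) (A.cross w z), A.trace_cross_left, A.trace_cross_left] at h
  linear_combination (norm := module) h

/-- Linearized form of the rule for `x ♯ (y ♯ z)`. -/
lemma cross_cross_cyclic (x y z : J) :
    A.cross x (A.cross y z) + A.cross y (A.cross x z) + A.cross z (A.cross x y)
      = A.tr x • (A.tr (A.cross y z) • A.one - A.cross y z)
        + A.tr y • (A.tr (A.cross x z) • A.one - A.cross x z)
        + A.tr z • (A.tr (A.cross x y) • A.one - A.cross x y)
        - (A.trace x (A.cross y z) • A.one + A.tr (A.cross y z) • x + A.tr (A.cross x z) • y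
          + A.tr (A.cross x y) • z) := by
  have h := A.cross_cross_cross_cyclic A.one x y z
  simp only [cross_one_left, cross_sub_left, cross_smul_left, trace_one_left] at h
  linear_combination (norm := module) -h

/-- This is `cross_cross_cross` with the base point as one of the arguments, solved for the iterated
product. -/
lemma cross_cross_self (x z : J) :
    A.cross x (A.cross x z) = A.tr x • (A.tr (A.cross x z) • A.one - A.cross x z)
      - A.quad x • z - A.trace (A.sharp x) z • A.one - A.tr (A.cross x z) • x
      + A.tr z • (A.quad x • A.one - A.sharp x) - A.cross (A.sharp x) z := by
  have h := A.cross_cross_cross x A.one z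
  simp only [cross_one_left, cross_one_right, cross_sub_left, cross_smul_left, trace_one_right,
    cross_sub_right, cross_smul_right, map_sub, map_smul, smul_eq_mul, tr_sharp] at h
  rw [tr_cross]
  rw [tr_cross] at h
  linear_combination (norm := module) -h

lemma cross_sharp_self (x : J) :
    A.cross x (A.sharp x) = (A.tr x * A.quad x - A.norm x) • A.one - A.tr x • A.sharp x
      - A.quad x • x := by
  have h := A.sharp_cross_cross x A.one
  simp only [cross_one_right, cross_sub_right, cross_smul_right, trace_one_right, tr_sharp] at h
  rw [cross_comm]
  linear_combination (norm := module) -h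

lemma trace_sharp_self (x : J) : A.trace (A.sharp x) x = 3 * A.norm x := by
  have h := congrArg A.tr (A.cross_sharp_self x)
  simp only [tr_cross, tr_sub, tr_smul, tr_one, tr_sharp] at h
  rw [A.trace_symm]
  linear_combination -h

lemma quad_sharp (x : J) : A.quad (A.sharp x) = A.norm x * A.tr x := by
  rw [quad, A.sharp_sharp, tr_smul]

/-! ### Iterated products with an element of trace zero. -/

section TraceZero

variable {A} {x : J}

lemma cross_sharp_self_of_tr_eq_zero (hx : A.tr x = 0) :
    A.cross x (A.sharp x) = -A.quad x • x - A.norm x • A.one := by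
  rw [cross_sharp_self, hx]; module

lemma cross_cross_self_of_tr_eq_zero (hx : A.tr x = 0) (z : J) :
    A.cross x (A.cross x z) = A.trace x z • x - A.quad x • z
      + (A.tr z * A.quad x - A.trace (A.sharp x) z) • A.one
      - A.tr z • A.sharp x - A.cross (A.sharp x) z := by
  rw [cross_cross_self, tr_cross, hx]; module

/-- In the cyclic identity for x, x♯, z the other two terms are known: one is the axiom for x♯ ♯ (x
♯ z), the other involves only x ♯ x♯. -/
lemma cross_sharp_cross_of_tr_eq_zero (hx : A.tr x = 0) (z : J) :
    A.cross x (A.cross (A.sharp x) z) = A.norm x • z + A.trace x z • A.sharp x := by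
  have h := A.cross_cross_cyclic x (A.sharp x) z
  rw [sharp_cross_cross, cross_sharp_self_of_tr_eq_zero hx] at h
  simp only [cross_sub_right, cross_smul_right, tr_cross, tr_sub, tr_smul, hx, tr_one, tr_sharp,
    cross_one_right, ← A.trace_cross_left, cross_sharp_self_of_tr_eq_zero hx,
    map_sub, map_smul, LinearMap.sub_apply, LinearMap.smul_apply, trace_one_left, smul_eq_mul,
    A.cross_comm z x] at h
  linear_combination (norm := module) h

lemma sharp_cross_sharp_cross_of_tr_eq_zero (hx : A.tr x = 0) (z : J) :
    A.cross (A.sharp x) (A.cross (A.sharp x) z)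
      = A.trace (A.sharp x) z • A.sharp x - A.quad x • A.cross (A.sharp x) z
        - A.norm x • A.cross x z - (A.quad x * A.trace (A.sharp x) z + A.norm x * A.trace x z
          - A.quad x ^ 2 * A.tr z) • A.one
        - (A.quad x * A.tr z) • A.sharp x - (A.tr z * A.norm x) • x := by
  rw [cross_cross_self, tr_cross, quad_sharp, A.sharp_sharp, tr_sharp, hx]
  simp only [cross_smul_left, map_smul, LinearMap.smul_apply, smul_eq_mul]
  module

end TraceZero

/-! ### Petersson's generators and their trace form. -/

variable {A}

lemma combo_peterssonGens (σ υ : J) (c : Coord k) :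
    combo (A.peterssonGens σ υ) c = c.p1 • A.one + c.p2 • σ + c.p3 • A.sharp σ + c.p4 • υ
      + c.u1 • A.sharp υ + c.u2 • A.cross σ υ + c.s1 • A.cross σ (A.sharp υ)
      + c.s2 • A.cross (A.sharp σ) υ + c.s3 • A.cross (A.sharp σ) (A.sharp υ) := rfl

lemma sum_smul_eq_combo (B : Fin 9 → J) (g : Fin 9 → k) :
    ∑ i, g i • B i = combo B ⟨g 0, g 1, g 2, g 3, g 4, g 5, g 6, g 7, g 8⟩ := by
  rw [Fin.sum_univ_castSucc, Fin.sum_univ_eight]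
  rfl

/-- The vector of Petersson's subalgebra dual, up to the factor `A.disc σ υ`, to the generator
`σ♯ ♯ υ♯` with respect to the trace form. -/
def dualTop (A : CubicJordan k J) (σ υ : J) : J :=
  let S1 := A.quad σ
  let S2 := A.quad υ
  let N1 := A.norm σ
  let N2 := A.norm υ
  let T11 := A.trace σ υ
  let T12 := A.trace σ (A.sharp υ)
  let T21 := A.trace (A.sharp σ) υ
  let T22 := A.trace (A.sharp σ) (A.sharp υ)
  combo (A.peterssonGens σ υ)
    ⟨2 * T22 ^ 2 + T11 * T12 * T21 - T11 ^ 2 * T22 + S1 * S2 * T11 ^ 2 - 2 * S1 ^ 2 * S2 ^ 2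
        + 4 * N2 * S1 * T21 + 4 * N1 * S2 * T12 + 3 * N1 * N2 * T11,
      -2 * T12 * T22 - 2 * N2 * S1 * T11 + 2 * N1 * S2 ^ 2,
      2 * T12 ^ 2 - 2 * S2 * T22 + 2 * S1 * S2 ^ 2 - 6 * N2 * T21,
      -2 * T21 * T22 + 2 * N2 * S1 ^ 2 - 2 * N1 * S2 * T11,
      2 * T21 ^ 2 - 2 * S1 * T22 + 2 * S1 ^ 2 * S2 - 6 * N1 * T12,
      -T12 * T21 - T11 * T22 + S1 * S2 * T11 + 9 * N1 * N2,
      2 * T11 * T21 + 2 * S1 * T12 + 6 * N1 * S2,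
      2 * T11 * T12 + 2 * S2 * T21 + 6 * N2 * S1,
      6 * T22 - 2 * T11 ^ 2 + 2 * S1 * S2⟩

section Pairings

variable {x : J}

lemma trace_cross_self (z : J) : A.trace x (A.cross x z) = 2 * A.trace (A.sharp x) z := by
  rw [← trace_cross_left, cross_self]; simp

lemma trace_sharp_cross_sharp (z : J) :
    A.trace (A.sharp x) (A.cross (A.sharp x) z) = 2 * A.norm x * A.trace x z := by
  rw [trace_cross_self, A.sharp_sharp]; simp [mul_assoc]

lemma trace_cross_sharp (hx : A.tr x = 0) (z : J) :
    A.trace x (A.cross (A.sharp x) z) = -A.quad x * A.trace x z - A.norm x * A.tr z := by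
  rw [← trace_cross_left, cross_sharp_self_of_tr_eq_zero hx]
  simp [trace_one_left]

lemma trace_sharp_cross (hx : A.tr x = 0) (z : J) :
    A.trace (A.sharp x) (A.cross x z) = -A.quad x * A.trace x z - A.norm x * A.tr z := by
  rw [← trace_cross_left, cross_comm, cross_sharp_self_of_tr_eq_zero hx]
  simp [trace_one_left]

lemma trace_cross_cross (hx : A.tr x = 0) (y z : J) :
    A.trace (A.cross x y) (A.cross x z) = A.trace x y * A.trace x z - A.quad x * A.trace y z
      + (A.tr y * A.quad x - A.trace (A.sharp x) y) * A.tr z - A.tr y * A.trace (A.sharp x) z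
      - A.trace (A.sharp x) (A.cross y z) := by
  rw [← trace_cross_left, A.cross_comm _ x, cross_cross_self_of_tr_eq_zero hx]
  simp [trace_one_left, trace_cross_left]

lemma trace_cross_sharp_cross (y z : J) :
    A.trace (A.cross x y) (A.cross (A.sharp x) z)
      = A.norm x * A.trace y z + A.trace (A.sharp x) y * A.trace x z := by
  rw [← trace_cross_left, A.cross_comm _ (A.sharp x), sharp_cross_cross]
  simp

lemma trace_sharp_cross_cross (y z : J) :
    A.trace (A.cross (A.sharp x) y) (A.cross x z)
      = A.norm x * A.trace y z + A.trace x y * A.trace (A.sharp x) z := by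
  rw [A.trace_symm, trace_cross_sharp_cross, A.trace_symm z y]; ring

lemma trace_sharp_cross_sharp_cross (hx : A.tr x = 0) (y z : J) :
    A.trace (A.cross (A.sharp x) y) (A.cross (A.sharp x) z)
      = A.trace (A.sharp x) y * A.trace (A.sharp x) z - A.quad x * A.trace (A.sharp x) (A.cross y z)
        - A.norm x * A.trace x (A.cross y z) - (A.quad x * A.trace (A.sharp x) y
          + A.norm x * A.trace x y - A.quad x ^ 2 * A.tr y) * A.tr z
        - (A.quad x * A.tr y) * A.trace (A.sharp x) z - (A.tr y * A.norm x) * A.trace x z := by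
  rw [← trace_cross_left, A.cross_comm _ (A.sharp x), sharp_cross_sharp_cross_of_tr_eq_zero hx]
  simp [trace_one_left, trace_cross_left]

end Pairings

variable {σ υ : J}

/-- The coefficients of `dualTop` solve the linear system given by the Gram matrix of the generators
with right-hand side `disc` times the last unit vector; the proof evaluates all Gram entries and
checks this. -/
lemma trace_dualTop (hσ : A.tr σ = 0) (hυ : A.tr υ = 0) (c : Coord k) :
    A.trace (A.dualTop σ υ) (combo (A.peterssonGens σ υ) c) = A.disc σ υ * c.s3 := by
  have e1 : A.trace υ σ = A.trace σ υ := A.trace_symm _ _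
  have e2 : A.trace (A.sharp υ) σ = A.trace σ (A.sharp υ) := A.trace_symm _ _
  have e3 : A.trace υ (A.sharp σ) = A.trace (A.sharp σ) υ := A.trace_symm _ _
  have e4 : A.trace (A.sharp υ) (A.sharp σ) = A.trace (A.sharp σ) (A.sharp υ) := A.trace_symm _ _
  have e5 : ∀ x : J, A.trace x (A.sharp x) = 3 * A.norm x := fun x => by
    rw [A.trace_symm, trace_sharp_self]
  have e6 : ∀ w : J, A.trace υ (A.cross w υ) = 2 * A.trace w (A.sharp υ) := fun w => by
    rw [cross_comm, trace_cross_self, A.trace_symm]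
  have e7 : ∀ w : J, A.trace υ (A.cross w (A.sharp υ))
      = -A.quad υ * A.trace w υ - A.norm υ * A.tr w := fun w => by
    rw [cross_comm, trace_cross_sharp hυ, A.trace_symm υ w]
  have e8 : ∀ w : J, A.trace (A.sharp υ) (A.cross w υ)
      = -A.quad υ * A.trace w υ - A.norm υ * A.tr w := fun w => by
    rw [cross_comm, trace_sharp_cross hυ, A.trace_symm υ w]
  have e9 : ∀ w : J, A.trace (A.sharp υ) (A.cross w (A.sharp υ))
      = 2 * A.norm υ * A.trace w υ := fun w => by
    rw [cross_comm, trace_sharp_cross_sharp, A.trace_symm υ w]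
  have f2 : ∀ w v x : J, A.trace (A.cross w v) x = A.trace x (A.cross w v) := fun _ _ _ =>
    A.trace_symm _ _
  have e10 : A.cross (A.sharp υ) υ = A.cross υ (A.sharp υ) := A.cross_comm _ _
  -- The pairing rules for σ reduce each entry to traces against products inside ⟨1, υ, υ♯⟩; e1–e10
  -- and f2 orient the arguments and evaluate those, leaving only the eight scalars.
  simp only [dualTop, combo_peterssonGens, map_add, map_smul, LinearMap.add_apply,
    LinearMap.smul_apply, smul_eq_mul, trace_one_left, trace_one_right, tr_one, quad_one, tr_cross,
    trace_cross_cross hσ, trace_cross_sharp_cross, trace_sharp_cross_cross,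
    trace_sharp_cross_sharp_cross hσ, f2 _ _ σ, f2 _ _ (A.sharp σ), f2 _ _ υ,
    f2 _ _ (A.sharp υ), f2 _ _ A.one,
    trace_cross_self, trace_cross_sharp hσ, trace_sharp_cross hσ,
    hσ, hυ, tr_sharp, trace_self, A.sharp_sharp, e1, e2, e3, e4, e5, e6, e7, e8, e9, quad_sharp,
    trace_sharp_self, cross_self, e10, cross_sharp_self_of_tr_eq_zero hυ, map_sub]
  simp only [disc, discPoly]
  ring

lemma coord_s3_eq_zero (hσ : A.tr σ = 0) (hυ : A.tr υ = 0) (hD : A.disc σ υ ≠ 0) {c : Coord k}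
    (h : combo (A.peterssonGens σ υ) c = 0) : c.s3 = 0 := by
  have h1 := trace_dualTop hσ hυ c
  rw [h, map_zero] at h1
  exact (mul_eq_zero.mp h1.symm).resolve_left hD

/-- Multiplication by `σ` on relations whose top coefficient vanishes. -/
lemma cross_fst_combo (hσ : A.tr σ = 0) (hυ : A.tr υ = 0) {c : Coord k} (hc : c.s3 = 0) :
    A.cross σ (combo (A.peterssonGens σ υ) c) = combo (A.peterssonGens σ υ)
      ⟨-c.p3 * A.norm σ - c.u2 * A.trace (A.sharp σ) υ
          + c.s1 * (A.quad υ * A.quad σ - A.trace (A.sharp σ) (A.sharp υ)),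
        -c.p1 - c.p3 * A.quad σ + c.u2 * A.trace σ υ + c.s1 * A.trace σ (A.sharp υ),
        2 * c.p2 - c.s1 * A.quad υ + c.s2 * A.trace σ υ,
        -c.u2 * A.quad σ + c.s2 * A.norm σ, -c.s1 * A.quad σ, c.p4, c.u1, -c.u2, -c.s1⟩ := by
  simp only [combo_peterssonGens, cross_add_right, cross_smul_right, cross_one_right, cross_self,
    cross_sharp_self_of_tr_eq_zero hσ, cross_cross_self_of_tr_eq_zero hσ,
    cross_sharp_cross_of_tr_eq_zero hσ, hσ, hυ, hc, tr_sharp]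
  module

/-- Multiplication by `υ` on relations whose top coefficient vanishes. -/
lemma cross_snd_combo (hσ : A.tr σ = 0) (hυ : A.tr υ = 0) {c : Coord k} (hc : c.s3 = 0) :
    A.cross υ (combo (A.peterssonGens σ υ) c) = combo (A.peterssonGens σ υ)
      ⟨-c.u1 * A.norm υ - c.u2 * A.trace σ (A.sharp υ)
          + c.s2 * (A.quad σ * A.quad υ - A.trace (A.sharp σ) (A.sharp υ)),
        -c.u2 * A.quad υ + c.s1 * A.norm υ, -c.s2 * A.quad υ,
        -c.p1 - c.u1 * A.quad υ + c.u2 * A.trace σ υ + c.s2 * A.trace (A.sharp σ) υ,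
        2 * c.p4 - c.s2 * A.quad σ + c.s1 * A.trace σ υ,
        c.p2, -c.u2, c.p3, -c.s2⟩ := by
  have e (w : J) : A.trace υ w = A.trace w υ := A.trace_symm _ _
  have e' (w : J) : A.trace (A.sharp υ) w = A.trace w (A.sharp υ) := A.trace_symm _ _
  simp only [combo_peterssonGens, cross_add_right, cross_smul_right, cross_one_right, cross_self,
    A.cross_comm σ, A.cross_comm (A.sharp σ),
    cross_sharp_self_of_tr_eq_zero hυ, cross_cross_self_of_tr_eq_zero hυ,
    cross_sharp_cross_of_tr_eq_zero hυ, hσ, hυ, hc, tr_sharp, e, e']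
  module

/-- Up to sign, each coefficient except that of 1 is the top coefficient or reappears, after
multiplication by σ or υ, in a position already known to vanish. What is left is a multiple of 1,
and 1 ≠ 0. -/
theorem linearIndependent_peterssonGens (hσ : A.tr σ = 0) (hυ : A.tr υ = 0)
    (hD : A.disc σ υ ≠ 0) : LinearIndependent k (A.peterssonGens σ υ) := by
  have s3 : ∀ c : Coord k, combo (A.peterssonGens σ υ) c = 0 → c.s3 = 0 :=
    fun c => coord_s3_eq_zero hσ hυ hD
  have fst : ∀ c : Coord k, combo (A.peterssonGens σ υ) c = 0 →
      A.cross σ (combo (A.peterssonGens σ υ) c) = 0 := fun c h => by rw [h, cross_zero_right]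
  have snd : ∀ c : Coord k, combo (A.peterssonGens σ υ) c = 0 →
      A.cross υ (combo (A.peterssonGens σ υ) c) = 0 := fun c h => by rw [h, cross_zero_right]
  have s1 : ∀ c : Coord k, combo (A.peterssonGens σ υ) c = 0 → c.s1 = 0 := fun c h =>
    neg_eq_zero.mp (s3 _ ((cross_fst_combo hσ hυ (s3 c h)).symm.trans (fst c h)))
  have s2 : ∀ c : Coord k, combo (A.peterssonGens σ υ) c = 0 → c.s2 = 0 := fun c h =>
    neg_eq_zero.mp (s3 _ ((cross_snd_combo hσ hυ (s3 c h)).symm.trans (snd c h)))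
  have u2 : ∀ c : Coord k, combo (A.peterssonGens σ υ) c = 0 → c.u2 = 0 := fun c h =>
    neg_eq_zero.mp (s2 _ ((cross_fst_combo hσ hυ (s3 c h)).symm.trans (fst c h)))
  have p4 : ∀ c : Coord k, combo (A.peterssonGens σ υ) c = 0 → c.p4 = 0 := fun c h =>
    u2 _ ((cross_fst_combo hσ hυ (s3 c h)).symm.trans (fst c h))
  have u1 : ∀ c : Coord k, combo (A.peterssonGens σ υ) c = 0 → c.u1 = 0 := fun c h =>
    s1 _ ((cross_fst_combo hσ hυ (s3 c h)).symm.trans (fst c h))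
  have p2 : ∀ c : Coord k, combo (A.peterssonGens σ υ) c = 0 → c.p2 = 0 := fun c h =>
    u2 _ ((cross_snd_combo hσ hυ (s3 c h)).symm.trans (snd c h))
  have p3 : ∀ c : Coord k, combo (A.peterssonGens σ υ) c = 0 → c.p3 = 0 := fun c h =>
    s2 _ ((cross_snd_combo hσ hυ (s3 c h)).symm.trans (snd c h))
  have p1 : ∀ c : Coord k, combo (A.peterssonGens σ υ) c = 0 → c.p1 = 0 := fun c h => by
    have h1 := h
    rw [combo_peterssonGens, p2 c h, p3 c h, p4 c h, u1 c h, u2 c h, s1 c h, s2 c h, s3 c h] at h1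
    simpa [A.one_ne_zero] using h1
  rw [Fintype.linearIndependent_iff]
  intro g hg
  rw [sum_smul_eq_combo] at hg
  intro i
  fin_cases i
  exacts [p1 _ hg, p2 _ hg, p3 _ hg, p4 _ hg, u1 _ hg, u2 _ hg, s1 _ hg, s2 _ hg, s3 _ hg]

/-! ### The cubic subalgebra ⟨y, z, 1⟩ and its action on J. -/

/-- The pair `y, z` spans, together with the base point, a subalgebra whose `♯`-product has the
normal form of a cubic ring with structure constants `a, b, c, d`. -/
structure IsCubicPair (A : CubicJordan k J) (y z : J) (a b c d : k) : Prop where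
  tr_fst : A.tr y = 0
  tr_snd : A.tr z = 0
  ne_zero : b ≠ 0
  sharp_fst : A.sharp y = a • y - b • z + (b * c - a ^ 2) • A.one
  sharp_snd : A.sharp z = d • y - c • z + (a * d - c ^ 2) • A.one
  cross_eq : A.cross y z = (2 * c) • y - (2 * a) • z + (b * d - a * c) • A.one
  norm_fst : A.norm y = b ^ 2 * d + 2 * a ^ 3 - 3 * a * b * c

/-- Substituting y♯ into the formula for y ♯ y♯ determines b (y ♯ z). Then y♯♯ = N(y)y, read off on
the independent vectors y, z, 1, gives N(y), s and s' in turn, with b ≠ 0 cancelled. -/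
lemma isCubicPair_of_sharp {y z : J} {a b c d s s' : k} (hy : A.tr y = 0) (hz : A.tr z = 0)
    (hb : b ≠ 0) (hli : ∀ α β γ : k, α • y + β • z + γ • A.one = 0 → α = 0 ∧ β = 0 ∧ γ = 0)
    (h1 : A.sharp y = a • y - b • z + s • A.one)
    (h2 : A.sharp z = d • y - c • z + s' • A.one) : A.IsCubicPair y z a b c d := by
  have hq : A.quad y = 3 * s := by
    rw [quad, h1, tr_add, tr_sub, tr_smul, tr_smul, tr_smul, hy, hz, tr_one]; ring
  have h12 : b • A.cross y z
      = (2 * a ^ 2 + 2 * s) • y - (2 * a * b) • z + (A.norm y + 2 * a * s) • A.one := by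
    have h := cross_sharp_self_of_tr_eq_zero hy
    rw [h1, cross_add_right, cross_sub_right, cross_smul_right, cross_smul_right,
      cross_smul_right, cross_self, h1, cross_one_right, hy, hq] at h
    linear_combination (norm := module) -h
  have h := A.sharp_sharp y
  have e : A.sharp (A.sharp y) = a ^ 2 • A.sharp y + b ^ 2 • A.sharp z + s ^ 2 • A.one
      - a • (b • A.cross y z) - (a * s) • y + (b * s) • z := by
    nth_rw 1 [h1]
    simp only [sub_eq_add_neg, ← neg_smul, sharp_add, sharp_smul, cross_smul_left,
      cross_smul_right, cross_one_right, tr_add, tr_smul, hy, hz, A.sharp_one]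
    module
  rw [e, h12, h1, h2] at h
  obtain ⟨k1, k2, k3⟩ := hli (b ^ 2 * d - a ^ 3 - 3 * a * s - A.norm y)
    (b * (a ^ 2 - b * c + s)) (a ^ 2 * s + b ^ 2 * s' + s ^ 2 - a * (A.norm y + 2 * a * s))
    (by linear_combination (norm := module) h)
  have hs : s = b * c - a ^ 2 := by
    have := (mul_eq_zero.mp k2).resolve_left hb
    linear_combination this
  subst hs
  have hN : A.norm y = b ^ 2 * d + 2 * a ^ 3 - 3 * a * b * c := by linear_combination -k1
  rw [hN] at k3 h12
  have hs' : s' = a * d - c ^ 2 := by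
    apply mul_left_cancel₀ (pow_ne_zero 2 hb)
    linear_combination k3
  subst hs'
  refine ⟨hy, hz, hb, h1, h2, smul_right_injective J hb ?_, hN⟩
  simp only [h12]
  module

namespace IsCubicPair

variable {y z : J} {a b c d : k} (h : A.IsCubicPair y z a b c d)
include h

lemma quad_fst : A.quad y = 3 * (b * c - a ^ 2) := by
  rw [quad, h.sharp_fst, tr_add, tr_sub, tr_smul, tr_smul, tr_smul, h.tr_fst, h.tr_snd, tr_one]
  ring

lemma quad_snd : A.quad z = 3 * (a * d - c ^ 2) := by
  rw [quad, h.sharp_snd, tr_add, tr_sub, tr_smul, tr_smul, tr_smul, h.tr_fst, h.tr_snd, tr_one]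
  ring

lemma trace_fst_snd : A.trace y z = -3 * (b * d - a * c) := by
  have e := A.tr_cross y z
  rw [h.cross_eq, tr_add, tr_sub, tr_smul, tr_smul, tr_smul, h.tr_fst, h.tr_snd, tr_one] at e
  linear_combination e

lemma cross_sharp_fst (w : J) : A.cross (A.sharp y) w
    = a • A.cross y w - b • A.cross z w + (b * c - a ^ 2) • (A.tr w • A.one - w) := by
  rw [h.sharp_fst, cross_add_left, cross_sub_left, cross_smul_left, cross_smul_left,
    cross_smul_left, cross_one_left]

lemma cross_sharp_snd (w : J) : A.cross (A.sharp z) w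
    = d • A.cross y w - c • A.cross z w + (a * d - c ^ 2) • (A.tr w • A.one - w) := by
  rw [h.sharp_snd, cross_add_left, cross_sub_left, cross_smul_left, cross_smul_left,
    cross_smul_left, cross_one_left]

lemma trace_sharp_fst (w : J) : A.trace (A.sharp y) w
    = a * A.trace y w - b * A.trace z w + (b * c - a ^ 2) * A.tr w := by
  rw [h.sharp_fst]; simp [trace_one_left]

lemma trace_sharp_snd (w : J) : A.trace (A.sharp z) w
    = d * A.trace y w - c * A.trace z w + (a * d - c ^ 2) * A.tr w := by
  rw [h.sharp_snd]; simp [trace_one_left]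

lemma trace_cross (w : J) : A.trace (A.cross y z) w
    = 2 * c * A.trace y w - 2 * a * A.trace z w + (b * d - a * c) * A.tr w := by
  rw [h.cross_eq]; simp [trace_one_left]

lemma cross_cross (w : J) : A.cross (A.cross y z) w
    = (2 * c) • A.cross y w - (2 * a) • A.cross z w
      + (b * d - a * c) • (A.tr w • A.one - w) := by
  rw [h.cross_eq, cross_add_left, cross_sub_left, cross_smul_left, cross_smul_left,
    cross_smul_left, cross_one_left]

lemma cross_fst_cross_fst (w : J) : A.cross y (A.cross y w)
    = (A.trace y w - a * A.tr w) • y + (b * A.tr w) • z - (2 * (b * c - a ^ 2)) • w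
      + (b * A.trace z w - a * A.trace y w) • A.one - a • A.cross y w + b • A.cross z w := by
  rw [cross_cross_self_of_tr_eq_zero h.tr_fst, h.cross_sharp_fst, h.trace_sharp_fst, h.quad_fst,
    h.sharp_fst]
  module

lemma cross_snd_cross_snd (w : J) : A.cross z (A.cross z w)
    = (A.trace z w + c * A.tr w) • z - (d * A.tr w) • y - (2 * (a * d - c ^ 2)) • w
      + (c * A.trace z w - d * A.trace y w) • A.one + c • A.cross z w - d • A.cross y w := by
  rw [cross_cross_self_of_tr_eq_zero h.tr_snd, h.cross_sharp_snd, h.trace_sharp_snd, h.quad_snd,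
    h.sharp_snd]
  module

/-- As b ≠ 0, z is a combination of y, y♯ and 1, so the rule follows from those for y ♯ (y ♯ w) and
y♯ ♯ (y ♯ w). -/
lemma cross_snd_cross_fst (w : J) : A.cross z (A.cross y w)
    = (A.trace z w - c * A.tr w) • y + (a * A.tr w) • z - (b * d - a * c) • w
      + (a * A.trace z w - c * A.trace y w) • A.one - c • A.cross y w + a • A.cross z w := by
  apply smul_right_injective J h.ne_zero
  have e := A.sharp_cross_cross y w
  rw [h.cross_sharp_fst, h.cross_fst_cross_fst, h.trace_sharp_fst, h.norm_fst, tr_cross,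
    h.tr_fst] at e
  linear_combination (norm := module) -e

lemma cross_fst_cross_snd (w : J) : A.cross y (A.cross z w)
    = (A.trace y w + a * A.tr w) • z - (c * A.tr w) • y - (b * d - a * c) • w
      + (a * A.trace z w - c * A.trace y w) • A.one - c • A.cross y w + a • A.cross z w := by
  have e := A.cross_cross_cyclic y z w
  rw [h.cross_snd_cross_fst, A.cross_comm w, h.cross_cross, ← A.trace_cross_left, h.trace_cross,
    tr_cross, tr_cross, tr_cross, h.tr_fst, h.tr_snd, h.trace_fst_snd, h.cross_eq] at e
  linear_combination (norm := module) e

end IsCubicPair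

/-! ### The multiplication table of the new basis. -/

lemma sharp_sum_nine (x1 x2 x3 x4 x5 x6 x7 x8 x9 : k) (e1 e2 e3 e4 e5 e6 e7 e8 e9 : J) :
    A.sharp (x1 • e1 + x2 • e2 + x3 • e3 + x4 • e4 + x5 • e5 + x6 • e6 + x7 • e7 + x8 • e8 + x9 • e9)
      = x1 ^ 2 • A.sharp e1 + x2 ^ 2 • A.sharp e2 + x3 ^ 2 • A.sharp e3 + x4 ^ 2 • A.sharp e4
      + x5 ^ 2 • A.sharp e5 + x6 ^ 2 • A.sharp e6 + x7 ^ 2 • A.sharp e7 + x8 ^ 2 • A.sharp e8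
      + x9 ^ 2 • A.sharp e9 + (x1 * x2) • A.cross e1 e2 + (x1 * x3) • A.cross e1 e3
      + (x1 * x4) • A.cross e1 e4 + (x1 * x5) • A.cross e1 e5 + (x1 * x6) • A.cross e1 e6
      + (x1 * x7) • A.cross e1 e7 + (x1 * x8) • A.cross e1 e8 + (x1 * x9) • A.cross e1 e9
      + (x2 * x3) • A.cross e2 e3 + (x2 * x4) • A.cross e2 e4 + (x2 * x5) • A.cross e2 e5
      + (x2 * x6) • A.cross e2 e6 + (x2 * x7) • A.cross e2 e7 + (x2 * x8) • A.cross e2 e8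
      + (x2 * x9) • A.cross e2 e9 + (x3 * x4) • A.cross e3 e4 + (x3 * x5) • A.cross e3 e5
      + (x3 * x6) • A.cross e3 e6 + (x3 * x7) • A.cross e3 e7 + (x3 * x8) • A.cross e3 e8
      + (x3 * x9) • A.cross e3 e9 + (x4 * x5) • A.cross e4 e5 + (x4 * x6) • A.cross e4 e6
      + (x4 * x7) • A.cross e4 e7 + (x4 * x8) • A.cross e4 e8 + (x4 * x9) • A.cross e4 e9
      + (x5 * x6) • A.cross e5 e6 + (x5 * x7) • A.cross e5 e7 + (x5 * x8) • A.cross e5 e8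
      + (x5 * x9) • A.cross e5 e9 + (x6 * x7) • A.cross e6 e7 + (x6 * x8) • A.cross e6 e8
      + (x6 * x9) • A.cross e6 e9 + (x7 * x8) • A.cross e7 e8 + (x7 * x9) • A.cross e7 e9
      + (x8 * x9) • A.cross e8 e9 := by
  simp only [sharp_add, sharp_smul, cross_add_left, cross_smul_left, cross_smul_right]
  module

lemma cross_cross_cross_right (x y z : J) :
    A.cross (A.cross y x) (A.cross z x) = A.trace (A.sharp x) y • z + A.trace (A.sharp x) z • y
      + A.trace x (A.cross y z) • x - A.cross (A.sharp x) (A.cross y z) := by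
  rw [A.cross_comm y, A.cross_comm z, cross_cross_cross]

section Associativity

variable {x : J}

lemma cross_cross_left (hx : A.tr x = 0) {u : J} (hu : A.tr u = 0) :
    A.cross (A.cross x u) x = A.trace x u • x - A.quad x • u - A.trace (A.sharp x) u • A.one
      - A.cross (A.sharp x) u := by
  rw [cross_comm, cross_cross_self_of_tr_eq_zero hx, hu]; module

lemma cross_sharp_cross_left (hx : A.tr x = 0) (u : J) :
    A.cross (A.cross (A.sharp x) u) x = A.norm x • u + A.trace x u • A.sharp x := by
  rw [cross_comm, cross_sharp_cross_of_tr_eq_zero hx]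

lemma cross_cross_sharp_left (u : J) :
    A.cross (A.cross x u) (A.sharp x) = A.norm x • u + A.trace (A.sharp x) u • x := by
  rw [cross_comm, sharp_cross_cross]

lemma cross_sharp_cross_sharp_left (hx : A.tr x = 0) {u : J} (hu : A.tr u = 0) :
    A.cross (A.cross (A.sharp x) u) (A.sharp x)
      = A.trace (A.sharp x) u • A.sharp x - A.quad x • A.cross (A.sharp x) u
        - A.norm x • A.cross x u
        - (A.quad x * A.trace (A.sharp x) u + A.norm x * A.trace x u) • A.one := by
  rw [cross_comm, sharp_cross_sharp_cross_of_tr_eq_zero hx, hu]; module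

/-- Cyclic identity for x, u, x♯ ♯ v. For u, v in a cubic pair the remaining product (x♯ ♯ v) ♯ u is
given by the pair's rules with w = x♯, and multiplying by x once more is again known. -/
lemma cross_cross_cross_sharp (hx : A.tr x = 0) {u v : J} (hu : A.tr u = 0) (hv : A.tr v = 0) :
    A.cross (A.cross x u) (A.cross (A.sharp x) v)
      = -A.cross x (A.cross (A.cross (A.sharp x) v) u) - A.norm x • A.cross u v
        - A.trace x v • A.cross (A.sharp x) u
        + A.trace (A.sharp x) v • (A.trace x u • A.one + A.cross x u)
        - (A.norm x * A.trace u v + A.trace (A.sharp x) u * A.trace x v) • A.one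
        + A.trace (A.sharp x) (A.cross u v) • x - (A.quad x * A.trace x v) • u
        + A.trace x u • A.cross (A.sharp x) v := by
  have e := A.cross_cross_cyclic x u (A.cross (A.sharp x) v)
  rw [← A.trace_cross_left, trace_cross_sharp_cross, A.cross_comm u (A.cross (A.sharp x) v),
    A.cross_comm _ (A.cross x u), cross_sharp_cross_of_tr_eq_zero hx, A.cross_comm u] at e
  simp only [tr_cross, hx, hu, hv, tr_sharp, tr_add, tr_smul, cross_add_left, cross_smul_left,
    A.trace_cross_left, A.cross_comm v u] at e
  linear_combination (norm := module) e

end Associativity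

namespace IsCubicPair

variable {y z : J} {a b c d : k} (h : A.IsCubicPair y z a b c d)
include h

lemma cross_fst_fst (w : J) : A.cross (A.cross w y) y
    = (A.trace w y - a * A.tr w) • y + (b * A.tr w) • z - (2 * (b * c - a ^ 2)) • w
      + (b * A.trace w z - a * A.trace w y) • A.one - a • A.cross w y + b • A.cross w z := by
  rw [A.cross_comm _ y, A.cross_comm w, A.cross_comm w, h.cross_fst_cross_fst, A.trace_symm w,
    A.trace_symm w]

lemma cross_snd_snd (w : J) : A.cross (A.cross w z) z
    = (A.trace w z + c * A.tr w) • z - (d * A.tr w) • y - (2 * (a * d - c ^ 2)) • w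
      + (c * A.trace w z - d * A.trace w y) • A.one + c • A.cross w z - d • A.cross w y := by
  rw [A.cross_comm _ z, A.cross_comm w, A.cross_comm w, h.cross_snd_cross_snd, A.trace_symm w,
    A.trace_symm w]

lemma cross_fst_snd (w : J) : A.cross (A.cross w y) z
    = (A.trace w z - c * A.tr w) • y + (a * A.tr w) • z - (b * d - a * c) • w
      + (a * A.trace w z - c * A.trace w y) • A.one - c • A.cross w y + a • A.cross w z := by
  rw [A.cross_comm _ z, A.cross_comm w, A.cross_comm w, h.cross_snd_cross_fst, A.trace_symm w,
    A.trace_symm w]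

lemma cross_snd_fst (w : J) : A.cross (A.cross w z) y
    = (A.trace w y + a * A.tr w) • z - (c * A.tr w) • y - (b * d - a * c) • w
      + (a * A.trace w z - c * A.trace w y) • A.one - c • A.cross w y + a • A.cross w z := by
  rw [A.cross_comm _ y, A.cross_comm w, A.cross_comm w, h.cross_fst_cross_snd, A.trace_symm w,
    A.trace_symm w]

end IsCubicPair

/-- The coordinates of `x♯` in the new basis. -/
def adCoord (t : Params k) (x : Coord k) : Coord k where
  p1 := F3 t x
  p2 := F1 t x
  p3 := F4 t x
  p4 := F2 t x
  u1 := -F5 t x - t.t1 * F1 t x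
  u2 := -F6 t x - t.t1 * F2 t x
  s1 := -F7 t x
  s2 := -F8 t x
  s3 := F9 t x + t.t1 * F7 t x + t.t125 * F3 t x - t.t123 * F1 t x + t.t126 * F4 t x
    - t.t124 * F2 t x

/-- Unfolding π₂ and π₄ shifts the coefficients of y and z by S(σ)p₂ and S(σ)p₄, hence the
combinations `u1 + t1 * p2` and `u2 + t1 * p4` in the equations for F₅ and F₆. -/
lemma combo_newBasis (σ y z : J) (x : Coord k) : combo (A.newBasis σ y z) x
    = x.p1 • A.cross σ y + x.p2 • A.cross (A.sharp σ) y + x.p3 • A.cross σ z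
      + x.p4 • A.cross (A.sharp σ) z + (x.u1 + A.quad σ * x.p2) • y
      + (x.u2 + A.quad σ * x.p4) • z + x.s1 • A.sharp σ + x.s2 • σ + x.s3 • A.one := by
  change x.p1 • A.cross σ y + x.p2 • (A.cross (A.sharp σ) y + A.quad σ • y) + x.p3 • A.cross σ z
    + x.p4 • (A.cross (A.sharp σ) z + A.quad σ • z) + x.u1 • y + x.u2 • z + x.s1 • A.sharp σ
    + x.s2 • σ + x.s3 • A.one = _
  module

set_option maxHeartbeats 4000000 in
theorem sharp_combo_newBasis {σ y z : J} {t : Params k} (hσ : A.tr σ = 0)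
    (ht : A.IsParams σ y z t) (h : A.IsCubicPair y z t.t136 t.t135 t.t245 t.t246) (x : Coord k) :
    A.sharp (combo (A.newBasis σ y z) x) = combo (A.newBasis σ y z) (adCoord t x) := by
  have hy := h.tr_fst
  have hz := h.tr_snd
  have w1 : A.quad σ = t.t1 := ht.t1_eq.symm
  have w2 : A.norm σ = t.t2 := ht.t2_eq.symm
  have w3 : A.trace (A.sharp σ) y = -t.t123 := by rw [ht.t123_eq, neg_neg]
  have w4 : A.trace (A.sharp σ) z = -t.t124 := by rw [ht.t124_eq, neg_neg]
  have w5 : A.trace σ y = t.t125 := ht.t125_eq.symm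
  have w6 : A.trace σ z = t.t126 := ht.t126_eq.symm
  have w7 : A.trace y σ = t.t125 := by rw [A.trace_symm, w5]
  have w8 : A.trace z σ = t.t126 := by rw [A.trace_symm, w6]
  have w9 : A.trace y (A.sharp σ) = -t.t123 := by rw [A.trace_symm, w3]
  have w10 : A.trace z (A.sharp σ) = -t.t124 := by rw [A.trace_symm, w4]
  have wzy : A.trace z y = -3 * (t.t135 * t.t246 - t.t136 * t.t245) := by
    rw [A.trace_symm, h.trace_fst_snd]
  have czy : A.cross z y = A.cross y z := A.cross_comm _ _
  have cs : A.cross (A.sharp σ) σ = A.cross σ (A.sharp σ) := A.cross_comm _ _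
  have c1 : A.cross y (A.sharp σ) = A.cross (A.sharp σ) y := A.cross_comm _ _
  have c2 : A.cross z (A.sharp σ) = A.cross (A.sharp σ) z := A.cross_comm _ _
  have c3 : A.cross y σ = A.cross σ y := A.cross_comm _ _
  have c4 : A.cross z σ = A.cross σ z := A.cross_comm _ _
  have m1 : A.cross (A.cross (A.sharp σ) y) (A.cross σ z)
      = A.cross (A.cross σ z) (A.cross (A.sharp σ) y) := A.cross_comm _ _
  have n1 : A.cross σ (A.cross (A.sharp σ) y) = A.norm σ • y + A.trace σ y • A.sharp σ :=
    cross_sharp_cross_of_tr_eq_zero hσ y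
  have n2 : A.cross σ (A.cross (A.sharp σ) z) = A.norm σ • z + A.trace σ z • A.sharp σ :=
    cross_sharp_cross_of_tr_eq_zero hσ z
  rw [combo_newBasis, combo_newBasis, sharp_sum_nine]
  -- Products of two products are first turned into nested ones; the second pass reduces these to
  -- the nine vectors and the ten parameters.
  simp only [A.cross_cross_cross_right y σ (A.sharp σ), A.cross_cross_cross_right z σ (A.sharp σ),
    m1, cross_cross_cross_sharp hσ hy hz, cross_cross_cross_sharp hσ hz hy, sharp_of_cross,
    A.cross_cross_cross σ y z, A.cross_cross_cross (A.sharp σ) y z]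
  simp only [cross_cross_left hσ hy, cross_cross_left hσ hz, cross_sharp_cross_left hσ,
    cross_cross_sharp_left, cross_sharp_cross_sharp_left hσ hy,
    cross_sharp_cross_sharp_left hσ hz, h.cross_fst_fst, h.cross_snd_snd, h.cross_fst_snd,
    h.cross_snd_fst, A.sharp_sharp, A.sharp_one, czy, cs, c1, c2, c3, c4, n1, n2, h.cross_eq,
    cross_sharp_self_of_tr_eq_zero hσ, cross_add_left, cross_sub_left, cross_smul_left,
    cross_add_right, cross_sub_right, cross_smul_right,
    cross_one_right, cross_one_left, h.sharp_fst, h.sharp_snd, map_add, map_sub, map_smul,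
    LinearMap.add_apply, LinearMap.sub_apply, LinearMap.smul_apply,
    smul_eq_mul, trace_one_left, trace_one_right, tr_add, tr_sub, tr_smul, tr_cross,
    tr_one, tr_sharp, hy, hz, hσ, w1, w2, w3, w4, w5, w6, w7, w8, w9, w10, wzy, h.trace_fst_snd]
  simp only [adCoord, F1, F2, F3, F4, F5, F6, F7, F8, F9]
  module

/-! ### Coordinates, admissible vectors and structure constants. -/

variable {υ₂ : J}

lemma combo_injective {B : Fin 9 → J} (hB : LinearIndependent k B) {x y : Coord k}
    (h : combo B x = combo B y) : x = y := by
  have key : ∀ c : Coord k, combo B c = ∑ i, ![c.p1, c.p2, c.p3, c.p4, c.u1, c.u2, c.s1, c.s2,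
      c.s3] i • B i := fun c => by rw [sum_smul_eq_combo]; rfl
  rw [key, key] at h
  have h1 := hB.fintypeLinearCombination_injective h
  have e (i : Fin 9) := congrFun h1 i
  obtain ⟨⟩ := x
  obtain ⟨⟩ := y
  congr 1
  exacts [e 0, e 1, e 2, e 3, e 4, e 5, e 6, e 7, e 8]

lemma combo_mem_span (B : Fin 9 → J) (x : Coord k) :
    combo B x ∈ Submodule.span k (Set.range B) := by
  have h (i : Fin 9) (a : k) : a • B i ∈ Submodule.span k (Set.range B) :=
    Submodule.smul_mem _ _ (Submodule.subset_span ⟨i, rfl⟩)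
  unfold combo
  repeat' apply Submodule.add_mem
  all_goals apply h

/-- The system is triangular in the coordinates of a, hence solved by back substitution. -/
lemma sharpRel_one_iff (t : Params k) (x a : Coord k) :
    SharpRel 1 t x a ↔ a = adCoord t x := by
  constructor
  · rintro ⟨h1, h2, h3, h4, h5, h6, h7, h8, h9⟩
    obtain ⟨p1, p2, p3, p4, u1, u2, s1, s2, s3⟩ := a
    simp only at h1 h2 h3 h4 h5 h6 h7 h8 h9
    simp only [adCoord, Coord.mk.injEq, ← h1, ← h2, ← h3, ← h4, ← h5, ← h6, ← h7, ← h8, ← h9]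
    refine ⟨?_, ?_, ?_, ?_, ?_, ?_, ?_, ?_, ?_⟩ <;> ring
  · rintro rfl
    refine ⟨?_, ?_, ?_, ?_, ?_, ?_, ?_, ?_, ?_⟩ <;> simp only [adCoord] <;> ring

lemma combo_smul (c : k) (B : Fin 9 → J) (x : Coord k) :
    combo (c • B) x = c • combo B x := by
  simp only [combo, Pi.smul_apply]; module

/-- The left-hand sides are linear in a and the right-hand sides free of it, so the factor 3 can be
absorbed into a. -/
lemma sharpRel_three_iff (t : Params k) (x a : Coord k) :
    SharpRel 3 t x a ↔ SharpRel 1 t x ⟨3 * a.p1, 3 * a.p2, 3 * a.p3, 3 * a.p4, 3 * a.u1, 3 * a.u2,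
      3 * a.s1, 3 * a.s2, 3 * a.s3⟩ := by
  unfold SharpRel
  refine and_congr ?_ (and_congr ?_ (and_congr ?_ (and_congr ?_ (and_congr ?_ (and_congr ?_
    (and_congr ?_ (and_congr ?_ ?_))))))) <;>
  · apply Eq.congr_left
    ring

lemma linearIndependent_triple (hli : LinearIndependent k (A.peterssonGens σ υ)) {α β γ : k}
    (h : α • υ + β • A.sharp υ + γ • A.one = 0) : α = 0 ∧ β = 0 ∧ γ = 0 := by
  have h1 : combo (A.peterssonGens σ υ) ⟨γ, 0, 0, α, β, 0, 0, 0, 0⟩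
      = combo (k := k) (A.peterssonGens σ υ) ⟨0, 0, 0, 0, 0, 0, 0, 0, 0⟩ := by
    simp only [combo_peterssonGens]
    linear_combination (norm := module) h
  have h2 := combo_injective hli h1
  simp only [Coord.mk.injEq] at h2
  tauto

/-- An admissible second vector has the form `α υ + β υ♯ + γ 1` with `β ≠ 0`. -/
lemma IsAdmissible.exists_eq (h3 : (3 : k) ≠ 0) (hυ : A.tr υ = 0)
    (hli : LinearIndependent k (A.peterssonGens σ υ)) (h : A.IsAdmissible υ υ₂) :
    ∃ α β : k, β ≠ 0 ∧ υ₂ = α • υ + β • (A.sharp υ - ((1 / 3 : k) * A.quad υ) • A.one) := by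
  obtain ⟨hs, ht⟩ := h
  have h2 : υ₂ ∈ Submodule.span k {υ, A.sharp υ, A.one} := by
    rw [hs]; exact Submodule.subset_span (by simp)
  have h1 : A.sharp υ ∈ Submodule.span k {υ, υ₂, A.one} := by
    rw [← hs]; exact Submodule.subset_span (by simp)
  rw [Submodule.mem_span_triple] at h1 h2
  obtain ⟨α, β, γ, rfl⟩ := h2
  obtain ⟨α', β', γ', h1⟩ := h1
  simp only [tr_add, tr_smul, tr_one, hυ, tr_sharp] at ht
  refine ⟨α, β, ?_, ?_⟩
  -- If β = 0, then υ₂ and hence υ♯ would lie in ⟨υ, 1⟩.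
  · rintro rfl
    have := linearIndependent_triple hli (α := α' + β' * α) (β := -1) (γ := β' * γ + γ')
      (by linear_combination (norm := module) h1)
    simp at this
  · have : γ = -(β * ((1 / 3 : k) * A.quad υ)) := by
      field_simp
      linear_combination ht
    rw [this]
    module

lemma isAdmissible_sharp_sub (h3 : (3 : k) ≠ 0) :
    A.IsAdmissible υ (A.sharp υ - ((1 / 3 : k) * A.quad υ) • A.one) := by
  constructor
  · apply le_antisymm <;> rw [Submodule.span_le] <;> rintro w (rfl | rfl | rfl) <;>
      rw [SetLike.mem_coe, Submodule.mem_span_triple]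
    · exact ⟨1, 0, 0, by module⟩
    · exact ⟨0, 1, (1 / 3 : k) * A.quad υ, by module⟩
    · exact ⟨0, 0, 1, by module⟩
    · exact ⟨1, 0, 0, by module⟩
    · exact ⟨0, 1, -((1 / 3 : k) * A.quad υ), by module⟩
    · exact ⟨0, 0, 1, by module⟩
  · rw [tr_sub, tr_smul, tr_sharp, tr_one]
    field_simp
    ring

/-- Structure constants exist for every admissible second vector. -/
lemma exists_sharp_eq (h3 : (3 : k) ≠ 0) (hυ : A.tr υ = 0) (hυ₂ : A.tr υ₂ = 0) {α β : k}
    (hβ : β ≠ 0) (h : υ₂ = α • υ + β • (A.sharp υ - ((1 / 3 : k) * A.quad υ) • A.one)) :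
    ∃ a b c d : k, A.sharp υ = a • υ - b • υ₂ + ((1 / 3 : k) * A.quad υ) • A.one ∧
      A.sharp υ₂ = d • υ - c • υ₂ + ((1 / 3 : k) * A.quad υ₂) • A.one := by
  -- The constants come from solving the formula for υ₂ for υ♯.
  have h1 : A.sharp υ = (-α / β) • υ - (-1 / β) • υ₂ + ((1 / 3 : k) * A.quad υ) • A.one := by
    apply smul_right_injective J hβ
    simp only [smul_add, smul_sub, smul_smul, mul_div_cancel₀ _ hβ]
    rw [h]
    module
  set s : k := (1 / 3 : k) * A.quad υ with hs
  have hq : A.quad υ = 3 * s := by rw [hs]; field_simp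
  have e1 : A.sharp υ₂ = (β ^ 2 * A.norm υ - 2 * α * β * s) • υ + (α ^ 2 + β ^ 2 * s) • A.sharp υ
      - (2 * β ^ 2 * s ^ 2 + α * β * A.norm υ) • A.one := by
    rw [h]
    simp only [sub_eq_add_neg, ← neg_smul, sharp_add, sharp_smul, cross_add_right,
      cross_smul_left, cross_smul_right, cross_one_right, A.sharp_one, A.sharp_sharp,
      cross_sharp_self_of_tr_eq_zero hυ, tr_smul, tr_sharp, hυ, hq, smul_add]
    module
  obtain ⟨d, c, g, e⟩ : ∃ d c g : k, A.sharp υ₂ = d • υ - c • υ₂ + g • A.one := by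
    rw [h1] at e1
    exact ⟨(β ^ 2 * A.norm υ - 2 * α * β * s) + (α ^ 2 + β ^ 2 * s) * (-α / β),
      (α ^ 2 + β ^ 2 * s) * (-1 / β),
      (α ^ 2 + β ^ 2 * s) * s - (2 * β ^ 2 * s ^ 2 + α * β * A.norm υ), by rw [e1]; module⟩
  refine ⟨-α / β, -1 / β, c, d, h1, ?_⟩
  -- Taking traces gives S(υ₂) = 3g, because υ and υ₂ are traceless.
  have hg : g = (1 / 3 : k) * A.quad υ₂ := by
    rw [quad, e, tr_add, tr_sub, tr_smul, tr_smul, tr_smul, hυ, hυ₂, tr_one]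
    field_simp
    ring
  rw [e, hg]

/-- Each Petersson generator is written in the new vectors by substituting the given expression for
υ♯. -/
lemma newBasis_span (hβ : LinearIndependent k (A.peterssonGens σ υ))
    (hdim : Module.finrank k J = 9) {a b s : k} (h : A.sharp υ = a • υ - b • υ₂ + s • A.one) :
    Submodule.span k (Set.range (A.newBasis σ υ υ₂)) = ⊤ := by
  have htop : Submodule.span k (Set.range (A.peterssonGens σ υ)) = ⊤ :=
    hβ.span_eq_top_of_card_eq_finrank (by simp [hdim])
  rw [eq_top_iff, ← htop, Submodule.span_le]
  have key (w : J) (x : Coord k) (hx : w = combo (A.newBasis σ υ υ₂) x) :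
      w ∈ Submodule.span k (Set.range (A.newBasis σ υ υ₂)) := hx ▸ combo_mem_span _ x
  have e (w : J) : A.cross w (A.sharp υ)
      = a • A.cross w υ - b • A.cross w υ₂ + s • (A.tr w • A.one - w) := by
    rw [h, cross_add_right, cross_sub_right, cross_smul_right, cross_smul_right, cross_smul_right,
      cross_one_right]
  rintro _ ⟨i, rfl⟩
  fin_cases i
  · exact key A.one ⟨0, 0, 0, 0, 0, 0, 0, 0, 1⟩ (by rw [combo_newBasis]; module)
  · exact key σ ⟨0, 0, 0, 0, 0, 0, 0, 1, 0⟩ (by rw [combo_newBasis]; module)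
  · exact key (A.sharp σ) ⟨0, 0, 0, 0, 0, 0, 1, 0, 0⟩ (by rw [combo_newBasis]; module)
  · exact key υ ⟨0, 0, 0, 0, 1, 0, 0, 0, 0⟩ (by rw [combo_newBasis]; module)
  · exact key (A.sharp υ) ⟨0, 0, 0, 0, a, -b, 0, 0, s⟩ (by rw [combo_newBasis, h]; module)
  · exact key (A.cross σ υ) ⟨1, 0, 0, 0, 0, 0, 0, 0, 0⟩ (by rw [combo_newBasis]; module)
  · exact key (A.cross σ (A.sharp υ)) ⟨a, 0, -b, 0, 0, 0, 0, -s, s * A.tr σ⟩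
      (by rw [combo_newBasis, e]; module)
  · exact key (A.cross (A.sharp σ) υ) ⟨0, 1, 0, 0, -A.quad σ, 0, 0, 0, 0⟩
      (by rw [combo_newBasis]; module)
  · exact key (A.cross (A.sharp σ) (A.sharp υ))
      ⟨0, a, 0, -b, -A.quad σ * a, A.quad σ * b, -s, 0, s * A.tr (A.sharp σ)⟩
      (by rw [combo_newBasis, e]; module)

end CubicJordan

/-! ### Assembly of the main theorem. -/

theorem mainTheorem5 {k J : Type*} [Field k] [AddCommGroup J] [Module k J]
    (h3 : (3 : k) ≠ 0) (A : CubicJordan k J) (hdim : Module.finrank k J = 9)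
    (σ υ : J) (hσ : A.tr σ = 0) (hυ : A.tr υ = 0) (hD : A.disc σ υ ≠ 0) :
    A.peterssonSpan σ υ = ⊤ ∧
    (∃ υ₂ : J, A.IsAdmissible υ υ₂) ∧
    ∀ υ₂ : J, A.IsAdmissible υ υ₂ →
      LinearIndependent k (A.newBasis σ υ υ₂) ∧
      Submodule.span k (Set.range (A.newBasis σ υ υ₂)) = ⊤ ∧
      (∃! t : CubicJordan.Params k, A.IsParams σ υ υ₂ t) ∧
      ∀ t : CubicJordan.Params k, A.IsParams σ υ υ₂ t →
        (∀ x a : CubicJordan.Coord k,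
          A.sharp (CubicJordan.combo (A.newBasis σ υ υ₂) x)
              = CubicJordan.combo (A.newBasis σ υ υ₂) a ↔
            CubicJordan.SharpRel 1 t x a) ∧
        (∀ x a : CubicJordan.Coord k,
          A.sharp (CubicJordan.combo ((1 / 3 : k) • A.newBasis σ υ υ₂) x)
              = CubicJordan.combo ((1 / 3 : k) • A.newBasis σ υ υ₂) a ↔
            CubicJordan.SharpRel 3 t x a) := by
  open CubicJordan in
  have hli := linearIndependent_peterssonGens hσ hυ hD
  refine ⟨hli.span_eq_top_of_card_eq_finrank (by simp [hdim]), ⟨_, isAdmissible_sharp_sub h3⟩, ?_⟩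
  intro υ₂ hυ₂
  obtain ⟨α, β, hβ, hv⟩ := hυ₂.exists_eq h3 hυ hli
  obtain ⟨a, b, c, d, e1, e2⟩ := exists_sharp_eq h3 hυ hυ₂.2 hβ hv
  have hspan := newBasis_span hli hdim e1
  have hli' : LinearIndependent k (A.newBasis σ υ υ₂) :=
    linearIndependent_of_top_le_span_of_card_eq_finrank hspan.ge (by simp [hdim])
  have htriple : ∀ α β γ : k, α • υ + β • υ₂ + γ • A.one = 0 → α = 0 ∧ β = 0 ∧ γ = 0 := by
    intro α β γ h
    have h1 : combo (A.newBasis σ υ υ₂) ⟨0, 0, 0, 0, α, β, 0, 0, γ⟩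
        = combo (k := k) (A.newBasis σ υ υ₂) ⟨0, 0, 0, 0, 0, 0, 0, 0, 0⟩ := by
      simp only [combo_newBasis]
      linear_combination (norm := module) h
    have h2 := combo_injective hli' h1
    simp only [Coord.mk.injEq] at h2
    tauto
  refine ⟨hli', hspan, ⟨⟨A.quad σ, A.norm σ, -A.trace (A.sharp σ) υ, -A.trace (A.sharp σ) υ₂,
    A.trace σ υ, A.trace σ υ₂, b, a, c, d⟩, ⟨rfl, rfl, rfl, rfl, rfl, rfl, e1, e2⟩, ?_⟩, ?_⟩
  · rintro ⟨t1, t2, t123, t124, t125, t126, t135, t136, t245, t246⟩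
      ⟨g1, g2, g3, g4, g5, g6, g7, g8⟩
    simp only at g1 g2 g3 g4 g5 g6 g7 g8
    obtain ⟨k1, k2, -⟩ := htriple (t136 - a) (b - t135) 0
      (by linear_combination (norm := module) e1 - g7)
    obtain ⟨k3, k4, -⟩ := htriple (t246 - d) (c - t245) 0
      (by linear_combination (norm := module) e2 - g8)
    simp only [Params.mk.injEq]
    exact ⟨g1, g2, g3, g4, g5, g6, (sub_eq_zero.mp k2).symm, sub_eq_zero.mp k1,
      (sub_eq_zero.mp k4).symm, sub_eq_zero.mp k3⟩
  · intro t ht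
    -- Otherwise υ♯ would lie in ⟨υ, 1⟩, against the independence of υ, υ♯, 1.
    have hb : t.t135 ≠ 0 := by
      intro h0
      have e := ht.sharp_fst
      rw [h0] at e
      have := linearIndependent_triple hli (α := t.t136) (β := -1) (γ := (1 / 3 : k) * A.quad υ)
        (by linear_combination (norm := module) -e)
      simp at this
    have hpair := isCubicPair_of_sharp hυ hυ₂.2 hb htriple ht.sharp_fst ht.sharp_snd
    have hmain : ∀ x a : Coord k, A.sharp (combo (A.newBasis σ υ υ₂) x)
        = combo (A.newBasis σ υ υ₂) a ↔ SharpRel 1 t x a := by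
      intro x a
      rw [sharp_combo_newBasis hσ ht hpair, sharpRel_one_iff]
      exact ⟨fun h => (combo_injective hli' h).symm, fun h => by rw [h]⟩
    refine ⟨hmain, fun x a => ?_⟩
    -- Scaling the basis by 1/3 multiplies ♯ by 1/9 but the target vector only by 1/3 = 3/9;
    -- cancelling 1/9 leaves the unscaled statement for 3a.
    rw [sharpRel_three_iff, ← hmain, combo_smul, combo_smul, sharp_smul]
    have e : combo (A.newBasis σ υ υ₂) ⟨3 * a.p1, 3 * a.p2, 3 * a.p3, 3 * a.p4, 3 * a.u1,
        3 * a.u2, 3 * a.s1, 3 * a.s2, 3 * a.s3⟩ = (3 : k) • combo (A.newBasis σ υ υ₂) a := by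
      simp only [combo]; module
    rw [e]
    have h9 : (1 / 3 : k) • combo (A.newBasis σ υ υ₂) a
        = (1 / 3 : k) ^ 2 • (3 : k) • combo (A.newBasis σ υ υ₂) a := by
      rw [smul_smul]; congr 1; field_simp
    rw [h9]
    exact (smul_right_injective J (pow_ne_zero 2 (one_div_ne_zero h3))).eq_iff
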